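/- Let $k$ be a perfect field of characteristic $p>0$. For a field extension $K/k$, let $K^{\mathrm{perf}}$ be the perfect closure of $K$, and let $\mathcal D_\infty(K/k)$ be the category of triples $(V,W,\psi)$, where $V$ is a finite dimensional $K$-vector space, $W$ is a finite dimensional $k$-vector space and $\psi\colon K^{\mathrm{perf}}\otimes_K V\to K^{\mathrm{perf}}\otimes_k W$ is a $K^{\mathrm{perf}}$-linear isomorphism; a morphism $(V,W,\psi)\to(V',W',\psi')$ is a pair consisting of a $K$-linear map $V\to V'$ and a $k$-linear map $W\to W'$ compatible with $\psi$ and $\psi'$. With the natural tensor product and the fibre functor $\omega\colon(V,W,\psi)\mapsto W$ it is a neutral Tannakian category over $k$. The local Nori fundamental group $\pi^{\mathrm L}(K/k)$ is its Tannakian group, that is, the affine group scheme over $k$ that represents the functor $R\mapsto\mathrm{Aut}^{\otimes}(R\otimes_k\omega)$ on commutative $k$-algebras. A $k$-homomorphism $K\to L$ of field extensions of $k$ induces a homomorphism $\pi^{\mathrm L}(L/k)\to\pi^{\mathrm L}(K/k)$, by restriction along the pullback functor $(V,W,\psi)\mapsto(L\otimes_K V,\,W,\,L^{\mathrm{perf}}\otimes_{K^{\mathrm{perf}}}\psi)$.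 **Theorem I.** Let $K/k$ be a field extension, and let $\mathrm{PI}(K)$ be the category of purely inseparable field extensions of $K$ and $K$-homomorphisms; there is at most one morphism between any two of its objects, so it is equivalent to a partially ordered set. 1. The contravariant functor $L\mapsto(\pi^{\mathrm L}(L/k)\to\pi^{\mathrm L}(K/k))$ from $\mathrm{PI}(K)$ to the category of affine group schemes over $k$ equipped with a homomorphism to $\pi^{\mathrm L}(K/k)$ is fully faithful. 2. For every $L\in\mathrm{PI}(K)$ the homomorphism $\pi^{\mathrm L}(L/k)\to\pi^{\mathrm L}(K/k)$ is a closed immersion. The resulting map, which sends $L$ to the closed subgroup scheme $\pi^{\mathrm L}(L/k)\subseteq\pi^{\mathrm L}(K/k)$, is well defined on the partially ordered set of isomorphism classes of $\mathrm{PI}(K)$, and it is an order-reversing embedding of that set into the closed subgroup schemes of $\pi^{\mathrm L}(K/k)$: for $L_1,L_2\in\mathrm{PI}(K)$ one has $\pi^{\mathrm L}(L_1/k)\subseteq\pi^{\mathrm L}(L_2/k)$ if and only if there is a $K$-homomorphism $L_2\to L_1$. -/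

import Mathlib

open CategoryTheory TensorProduct

universe u

noncomputable section

namespace LocalNori

/-! ### Perfect closures -/

section Perf

variable (p : ℕ) [Fact p.Prime]

/-- The perfect closure of `K` is an algebra over every ring over which `K` is an algebra
(in particular over `K` itself). -/
instance perfAlgebra (k K : Type u) [Field k] [Field K] [CharP K p] [Algebra k K] :
    Algebra k (PerfectClosure K p) :=
  ((PerfectClosure.of K p).comp (algebraMap k K)).toAlgebra

theorem algebraMap_perf (k K : Type u) [Field k] [Field K] [CharP K p] [Algebra k K] (x : k) :
    algebraMap k (PerfectClosure K p) x = PerfectClosure.of K p (algebraMap k K x) := rfl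

instance perfTower (k K L : Type u) [Field k] [Field K] [Field L] [CharP L p] [Algebra k K]
    [Algebra k L] [Algebra K L] [IsScalarTower k K L] :
    IsScalarTower k K (PerfectClosure L p) :=
  IsScalarTower.of_algebraMap_eq fun x => by
    rw [algebraMap_perf, algebraMap_perf, IsScalarTower.algebraMap_apply k K L]

/-- The homomorphism of perfect closures induced by a homomorphism of fields over `k`. -/
def perfMap {k K L : Type u} [Field k] [Field K] [Field L] [CharP K p] [CharP L p]
    [Algebra k K] [Algebra k L] (f : K →ₐ[k] L) :
    PerfectClosure K p →ₐ[k] PerfectClosure L p where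
  __ := PerfectClosure.lift K p (PerfectClosure L p) ((PerfectClosure.of L p).comp f.toRingHom)
  commutes' x := by
    have h := (PerfectClosure.lift K p (PerfectClosure L p)).symm_apply_apply
      ((PerfectClosure.of L p).comp f.toRingHom)
    have h' := RingHom.congr_fun h (algebraMap k K x)
    have h'' : PerfectClosure.of L p (f (algebraMap k K x)) = algebraMap k _ x := by
      rw [AlgHom.commutes]; rfl
    exact h'.trans h''

theorem perfMap_of {k K L : Type u} [Field k] [Field K] [Field L] [CharP K p] [CharP L p]
    [Algebra k K] [Algebra k L] (f : K →ₐ[k] L) (x : K) :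
    perfMap p f (PerfectClosure.of K p x) = PerfectClosure.of L p (f x) :=
  RingHom.congr_fun ((PerfectClosure.lift K p (PerfectClosure L p)).symm_apply_apply
      ((PerfectClosure.of L p).comp f.toRingHom)) x

theorem perfMap_unique {k K L : Type u} [Field k] [Field K] [Field L] [CharP K p] [CharP L p]
    [Algebra k K] [Algebra k L] {g h : PerfectClosure K p →ₐ[k] PerfectClosure L p}
    (H : ∀ x, g (PerfectClosure.of K p x) = h (PerfectClosure.of K p x)) : g = h := by
  have : (g : PerfectClosure K p →+* PerfectClosure L p) = h :=
    (PerfectClosure.lift K p (PerfectClosure L p)).symm.injective (RingHom.ext H)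
  exact AlgHom.ext (RingHom.congr_fun this)

theorem perfMap_id {k K : Type u} [Field k] [Field K] [CharP K p] [Algebra k K] :
    perfMap p (AlgHom.id k K) = AlgHom.id k _ :=
  perfMap_unique p fun x => by rw [perfMap_of]; rfl

theorem perfMap_comp {k K L M : Type u} [Field k] [Field K] [Field L] [Field M] [CharP K p]
    [CharP L p] [CharP M p] [Algebra k K] [Algebra k L] [Algebra k M]
    (g : L →ₐ[k] M) (f : K →ₐ[k] L) :
    perfMap p (g.comp f) = (perfMap p g).comp (perfMap p f) :=
  perfMap_unique p fun x => by
    rw [AlgHom.comp_apply, perfMap_of, perfMap_of, perfMap_of]; rfl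

end Perf

/-! ### The category of triples -/

section Triples

variable (p : ℕ) [Fact p.Prime] (k K : Type u) [Field k] [Field K] [CharP K p] [Algebra k K]

/-- Triples `(V, W, ψ)`: a finite dimensional `K`-vector space `V`, a finite dimensional
`k`-vector space `W`, and a linear isomorphism between their extensions to the perfect closure
of `K`. -/
structure Triple where
  V : Type u
  W : Type u
  [addCommGroupV : AddCommGroup V]
  [moduleV : Module K V]
  [finiteV : FiniteDimensional K V]
  [addCommGroupW : AddCommGroup W]
  [moduleW : Module k W]
  [finiteW : FiniteDimensional k W]
  ψ : PerfectClosure K p ⊗[K] V ≃ₗ[PerfectClosure K p] PerfectClosure K p ⊗[k] W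

attribute [instance] Triple.addCommGroupV Triple.moduleV Triple.finiteV Triple.addCommGroupW
  Triple.moduleW Triple.finiteW

variable {p k K}

namespace Triple

/-- Morphisms of triples: pairs of linear maps compatible with the isomorphisms. -/
@[ext]
structure Hom (X Y : Triple p k K) where
  a : X.V →ₗ[K] Y.V
  b : X.W →ₗ[k] Y.W
  comm : ∀ z, Y.ψ (a.baseChange (PerfectClosure K p) z) =
    b.baseChange (PerfectClosure K p) (X.ψ z)

instance : Category (Triple p k K) where
  Hom := Hom
  id X := ⟨LinearMap.id, LinearMap.id, fun z => by simp⟩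
  comp f g := ⟨g.a ∘ₗ f.a, g.b ∘ₗ f.b, fun z => by
    simp [LinearMap.baseChange_comp, f.comm, g.comm]⟩

/-- The tensor product of triples. -/
def tensor (X Y : Triple p k K) : Triple p k K where
  V := X.V ⊗[K] Y.V
  W := X.W ⊗[k] Y.W
  ψ := AlgebraTensorModule.distribBaseChange K (PerfectClosure K p) X.V Y.V ≪≫ₗ
    TensorProduct.congr X.ψ Y.ψ ≪≫ₗ
    (AlgebraTensorModule.distribBaseChange k (PerfectClosure K p) X.W Y.W).symm

variable (p k K) in
/-- The unit triple `(K, k, id)`. -/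
def unit : Triple p k K where
  V := K
  W := k
  ψ := AlgebraTensorModule.rid K (PerfectClosure K p) (PerfectClosure K p) ≪≫ₗ
    (AlgebraTensorModule.rid k (PerfectClosure K p) (PerfectClosure K p)).symm

end Triple

end Triples

/-! ### Tensor automorphisms of the fibre functor -/

section Push

variable {k : Type u} [Field k] {R S T : Type u} [CommRing R] [CommRing S] [CommRing T]
  [Algebra k R] [Algebra k S] [Algebra k T] (W : Type u) [AddCommGroup W] [Module k W]

/-- The change of coefficients `R ⊗ W → S ⊗ W` along `f : R → S`. -/
abbrev coeffMap (f : R →ₐ[k] S) : R ⊗[k] W →ₗ[k] S ⊗[k] W := f.toLinearMap.rTensor W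

theorem coeffMap_smul (f : R →ₐ[k] S) (r : R) (z : R ⊗[k] W) :
    coeffMap W f (r • z) = f r • coeffMap W f z := by
  induction z with
  | zero => simp
  | tmul a w => simp [TensorProduct.smul_tmul']
  | add x y hx hy => simp only [smul_add, map_add, hx, hy]

/-- The base change along `f : R → S` of an endomorphism of the `R`-module `R ⊗ W`: the unique
endomorphism of the `S`-module `S ⊗ W` compatible with it, see `pushEnd_coeffMap`. -/
def pushEndFun (f : R →ₐ[k] S) (g : Module.End R (R ⊗[k] W)) : Module.End S (S ⊗[k] W) :=
  LinearMap.liftBaseChange S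
    (coeffMap W f ∘ₗ g.restrictScalars k ∘ₗ TensorProduct.mk k R W 1)

theorem pushEndFun_coeffMap (f : R →ₐ[k] S) (g : Module.End R (R ⊗[k] W)) (z : R ⊗[k] W) :
    pushEndFun W f g (coeffMap W f z) = coeffMap W f (g z) := by
  induction z with
  | zero => simp
  | tmul a w =>
    have : a ⊗ₜ[k] w = a • ((1 : R) ⊗ₜ[k] w) := by simp [TensorProduct.smul_tmul']
    rw [this, coeffMap_smul, map_smul, map_smul, coeffMap_smul]
    simp [pushEndFun]
  | add x y hx hy => simp only [map_add, hx, hy]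

theorem end_ext_coeffMap (f : R →ₐ[k] S) {M : Type u} [AddCommGroup M] [Module S M]
    {g h : S ⊗[k] W →ₗ[S] M}
    (H : ∀ z : R ⊗[k] W, g (coeffMap W f z) = h (coeffMap W f z)) : g = h := by
  refine LinearMap.ext fun z => ?_
  induction z with
  | zero => simp
  | add x y hx hy => simp only [map_add, hx, hy]
  | tmul a w =>
    have h : a ⊗ₜ[k] w = a • coeffMap W f (1 ⊗ₜ w) := by simp [TensorProduct.smul_tmul']
    rw [h, map_smul, map_smul, H]

/-- Base change of endomorphisms as a homomorphism of monoids. -/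
def pushEnd (f : R →ₐ[k] S) : Module.End R (R ⊗[k] W) →* Module.End S (S ⊗[k] W) where
  toFun := pushEndFun W f
  map_one' := end_ext_coeffMap W f fun z => by rw [pushEndFun_coeffMap]; rfl
  map_mul' g h := end_ext_coeffMap W f fun z => by
    rw [pushEndFun_coeffMap, Module.End.mul_apply, Module.End.mul_apply, pushEndFun_coeffMap,
      pushEndFun_coeffMap]

theorem pushEnd_coeffMap (f : R →ₐ[k] S) (g : Module.End R (R ⊗[k] W)) (z : R ⊗[k] W) :
    pushEnd W f g (coeffMap W f z) = coeffMap W f (g z) := pushEndFun_coeffMap W f g z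

theorem coeffMap_comp_apply (f : R →ₐ[k] S) (g : S →ₐ[k] T) (z : R ⊗[k] W) :
    coeffMap W (g.comp f) z = coeffMap W g (coeffMap W f z) := by
  rw [coeffMap, AlgHom.comp_toLinearMap, LinearMap.rTensor_comp]; rfl

theorem coeffMap_baseChange {W W' : Type u} [AddCommGroup W] [Module k W] [AddCommGroup W']
    [Module k W'] (f : R →ₐ[k] S) (b : W →ₗ[k] W') (z : R ⊗[k] W) :
    coeffMap W' f (b.baseChange R z) = b.baseChange S (coeffMap W f z) := by
  induction z with
  | zero => simp
  | tmul a w => simp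
  | add x y hx hy => simp only [map_add, hx, hy]

theorem coeffMap_distrib {W W' : Type u} [AddCommGroup W] [Module k W] [AddCommGroup W']
    [Module k W'] (f : R →ₐ[k] S) (z : R ⊗[k] W) (z' : R ⊗[k] W') :
    coeffMap (W ⊗[k] W') f ((AlgebraTensorModule.distribBaseChange k R W W').symm (z ⊗ₜ z')) =
      (AlgebraTensorModule.distribBaseChange k S W W').symm
        (coeffMap W f z ⊗ₜ coeffMap W' f z') := by
  induction z with
  | zero => simp
  | add x y hx hy => simp only [map_add, hx, hy, TensorProduct.add_tmul]
  | tmul a w =>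
    induction z' with
    | zero => simp
    | add x y hx hy => simp only [map_add, hx, hy, TensorProduct.tmul_add]
    | tmul a' w' => simp [AlgebraTensorModule.distribBaseChange_symm_tmul]

end Push

section Aut

variable (p : ℕ) [Fact p.Prime] (k K : Type u) [Field k] [Field K] [CharP K p] [Algebra k K]

variable {p k K} in
/-- The canonical isomorphism `(R ⊗ W) ⊗_R (R ⊗ W') ≃ R ⊗ (W ⊗ W')`, where `W` and `W'` are the
images of two triples under the fibre functor; `W ⊗ W'` is the image of their tensor product. -/
def tensorIso (R : Type u) [CommRing R] [Algebra k R] (X Y : Triple p k K) :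
    (R ⊗[k] X.W) ⊗[R] (R ⊗[k] Y.W) ≃ₗ[R] R ⊗[k] (X.tensor Y).W :=
  (AlgebraTensorModule.distribBaseChange k R X.W Y.W).symm

variable {p k K} in
theorem coeffMap_tensorIso {R S : Type u} [CommRing R] [Algebra k R] [CommRing S] [Algebra k S]
    (f : R →ₐ[k] S) (X Y : Triple p k K) (z : R ⊗[k] X.W) (z' : R ⊗[k] Y.W) :
    coeffMap (X.tensor Y).W f (tensorIso R X Y (z ⊗ₜ z')) =
      tensorIso S X Y (coeffMap X.W f z ⊗ₜ coeffMap Y.W f z') :=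
  coeffMap_distrib f z z'

/-- The conditions on a family `g` of `R`-linear automorphisms of the modules `R ⊗ W`, for
`(V, W, ψ)` a triple, to be a tensor automorphism of the functor `(V, W, ψ) ↦ R ⊗ W`. -/
structure IsTensorAut (R : Type u) [CommRing R] [Algebra k R]
    (g : ∀ X : Triple p k K, (Module.End R (R ⊗[k] X.W))ˣ) : Prop where
  natural : ∀ {X Y : Triple p k K} (f : X ⟶ Y) (z : R ⊗[k] X.W),
    (g Y).val (f.b.baseChange R z) = f.b.baseChange R ((g X).val z)
  tensor : ∀ (X Y : Triple p k K) (z : R ⊗[k] X.W) (z' : R ⊗[k] Y.W),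
    (g (X.tensor Y)).val (tensorIso R X Y (z ⊗ₜ z')) =
      tensorIso R X Y ((g X).val z ⊗ₜ (g Y).val z')
  unit : ∀ z : R ⊗[k] (Triple.unit p k K).W, (g (Triple.unit p k K)).val z = z

/-- The group of tensor automorphisms of the functor `(V, W, ψ) ↦ R ⊗ W`. -/
def tensorAut (R : Type u) [CommRing R] [Algebra k R] :
    Subgroup (∀ X : Triple p k K, (Module.End R (R ⊗[k] X.W))ˣ) where
  carrier := {g | IsTensorAut p k K R g}
  one_mem' := ⟨fun _ _ => rfl, fun _ _ _ _ => rfl, fun _ => rfl⟩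
  mul_mem' {g h} hg hh :=
    ⟨fun f z => by
      simp only [Pi.mul_apply, Units.val_mul, Module.End.mul_apply, hh.natural, hg.natural],
     fun X Y z z' => by
      simp only [Pi.mul_apply, Units.val_mul, Module.End.mul_apply, hh.tensor, hg.tensor],
     fun z => by
      simp only [Pi.mul_apply, Units.val_mul, Module.End.mul_apply, hh.unit, hg.unit]⟩
  inv_mem' {g} hg := by
    have l : ∀ X z, (g X).val ((g X)⁻¹.val z) = z := fun X z => by
      rw [← Module.End.mul_apply, Units.mul_inv]; rfl
    have r : ∀ X z, (g X)⁻¹.val ((g X).val z) = z := fun X z => by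
      rw [← Module.End.mul_apply, Units.inv_mul]; rfl
    refine ⟨fun {X Y} f z => ?_, fun X Y z z' => ?_, fun z => ?_⟩
    · have := hg.natural f ((g X)⁻¹.val z)
      rw [l] at this
      rw [Pi.inv_apply, ← this, r]; rfl
    · have := hg.tensor X Y ((g X)⁻¹.val z) ((g Y)⁻¹.val z')
      rw [l, l] at this
      rw [Pi.inv_apply, ← this, r]; rfl
    · have := hg.unit z
      rw [Pi.inv_apply, ← this, r]; exact this.symm

variable {p k K} in
theorem coeffMap_units {R S : Type u} [CommRing R] [Algebra k R] [CommRing S] [Algebra k S]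
    (f : R →ₐ[k] S) (W : Type u) [AddCommGroup W] [Module k W]
    (g : (Module.End R (R ⊗[k] W))ˣ) (z : R ⊗[k] W) :
    (Units.map (pushEnd W f) g).val (coeffMap W f z) = coeffMap W f (g.val z) :=
  pushEnd_coeffMap W f g.val z

/-- Base change of tensor automorphisms. -/
def tensorAutMap {R S : Type u} [CommRing R] [Algebra k R] [CommRing S] [Algebra k S]
    (f : R →ₐ[k] S) : tensorAut p k K R →* tensorAut p k K S where
  toFun g := ⟨fun X => Units.map (pushEnd X.W f) (g.1 X), by
    have hg : IsTensorAut p k K R g.1 := g.2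
    refine ⟨fun {X Y} b z => ?_, fun X Y z z' => ?_, fun z => ?_⟩
    · suffices h : (Units.map (pushEnd Y.W f) (g.1 Y)).val ∘ₗ b.b.baseChange S =
          b.b.baseChange S ∘ₗ (Units.map (pushEnd X.W f) (g.1 X)).val from LinearMap.congr_fun h z
      refine end_ext_coeffMap X.W f fun z => ?_
      rw [LinearMap.comp_apply, LinearMap.comp_apply, ← coeffMap_baseChange, coeffMap_units,
        hg.natural, coeffMap_units, coeffMap_baseChange]
    · induction z with
      | zero => simp
      | add x y hx hy => simp only [map_add, hx, hy, TensorProduct.add_tmul]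
      | tmul a w =>
        induction z' with
        | zero => simp
        | add x y hx hy => simp only [map_add, hx, hy, TensorProduct.tmul_add]
        | tmul a' w' =>
          have h1 : a ⊗ₜ[k] w = a • coeffMap X.W f (1 ⊗ₜ w) := by
            simp [TensorProduct.smul_tmul']
          have h2 : a' ⊗ₜ[k] w' = a' • coeffMap Y.W f (1 ⊗ₜ w') := by
            simp [TensorProduct.smul_tmul']
          rw [h1, h2]
          simp only [TensorProduct.smul_tmul_smul, map_smul]
          rw [← coeffMap_tensorIso, coeffMap_units, coeffMap_units, coeffMap_units, hg.tensor,
            coeffMap_tensorIso]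
    · suffices h : (Units.map (pushEnd (Triple.unit p k K).W f) (g.1 (Triple.unit p k K))).val =
          LinearMap.id from LinearMap.congr_fun h z
      refine end_ext_coeffMap _ f fun z => ?_
      rw [coeffMap_units, hg.unit]; rfl⟩
  map_one' := Subtype.ext (funext fun X => map_one _)
  map_mul' g h := Subtype.ext (funext fun X => map_mul _ _ _)

end Aut

/-! ### Pullback of triples and functoriality -/

section Pullback

variable {p : ℕ} [Fact p.Prime] {k K L M : Type u} [Field k] [Field K] [Field L] [Field M]
  [CharP K p] [CharP L p] [CharP M p] [Algebra k K] [Algebra k L] [Algebra k M]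

/-- The isomorphism of a pulled back triple: the extension of `ψ` along `K^perf → L^perf`, with
the identifications `L^perf ⊗_L (L ⊗_K V) = L^perf ⊗_{K^perf} (K^perf ⊗_K V)` and
`L^perf ⊗_{K^perf} (K^perf ⊗_k W) = L^perf ⊗_k W`. -/
def pullbackIso [Algebra K L] [Algebra (PerfectClosure K p) (PerfectClosure L p)]
    [IsScalarTower K (PerfectClosure K p) (PerfectClosure L p)]
    [IsScalarTower k (PerfectClosure K p) (PerfectClosure L p)] (X : Triple p k K) :
    PerfectClosure L p ⊗[L] (L ⊗[K] X.V) ≃ₗ[PerfectClosure L p] PerfectClosure L p ⊗[k] X.W :=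
  AlgebraTensorModule.cancelBaseChange K L (PerfectClosure L p) (PerfectClosure L p) X.V ≪≫ₗ
  (AlgebraTensorModule.cancelBaseChange K (PerfectClosure K p) (PerfectClosure L p)
    (PerfectClosure L p) X.V).symm ≪≫ₗ
  LinearEquiv.baseChange (PerfectClosure K p) (PerfectClosure L p) _ _ X.ψ ≪≫ₗ
  AlgebraTensorModule.cancelBaseChange k (PerfectClosure K p) (PerfectClosure L p)
    (PerfectClosure L p) X.W

/-- The pullback of a triple along a homomorphism `f : K → L` of extensions of `k`, with
underlying vector spaces `L ⊗_K V` and `W`. -/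
def Triple.pullback (f : K →ₐ[k] L) (X : Triple p k K) : Triple p k L :=
  letI : Algebra K L := f.toRingHom.toAlgebra
  letI : Algebra (PerfectClosure K p) (PerfectClosure L p) := (perfMap p f).toRingHom.toAlgebra
  haveI : IsScalarTower K (PerfectClosure K p) (PerfectClosure L p) :=
    IsScalarTower.of_algebraMap_eq fun x => (perfMap_of p f x).symm
  haveI : IsScalarTower k (PerfectClosure K p) (PerfectClosure L p) :=
    IsScalarTower.of_algebraMap_eq fun x => ((perfMap p f).commutes x).symm
  { V := L ⊗[K] X.V
    W := X.W
    ψ := pullbackIso X }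

/-- Morphisms of triples over a homomorphism `f : K → L`: an `f`-semilinear map and a `k`-linear
map, compatible with the isomorphisms. They are the morphisms out of the pullback along `f`. -/
structure SemiHom (f : K →ₐ[k] L) (X : Triple p k K) (Y : Triple p k L) where
  a : X.V →ₛₗ[(f : K →+* L)] Y.V
  b : X.W →ₗ[k] Y.W
  comm : ∀ v, Y.ψ (1 ⊗ₜ a v) = TensorProduct.map (perfMap p f).toLinearMap b (X.ψ (1 ⊗ₜ v))

/-- The canonical morphism from a triple to its pullback. -/
def SemiHom.toPullback (f : K →ₐ[k] L) (X : Triple p k K) : SemiHom f X (X.pullback f) :=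
  letI : Algebra K L := f.toRingHom.toAlgebra
  letI : Algebra (PerfectClosure K p) (PerfectClosure L p) := (perfMap p f).toRingHom.toAlgebra
  haveI : IsScalarTower K (PerfectClosure K p) (PerfectClosure L p) :=
    IsScalarTower.of_algebraMap_eq fun x => (perfMap_of p f x).symm
  haveI : IsScalarTower k (PerfectClosure K p) (PerfectClosure L p) :=
    IsScalarTower.of_algebraMap_eq fun x => ((perfMap p f).commutes x).symm
  { a :=
    { toFun := fun v => (1 : L) ⊗ₜ[K] v
      map_add' := fun v w => TensorProduct.tmul_add _ _ _
      map_smul' := fun c v => by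
        change (1 : L) ⊗ₜ[K] (c • v) = (f c) • ((1 : L) ⊗ₜ[K] v)
        rw [← TensorProduct.smul_tmul, TensorProduct.smul_tmul', Algebra.smul_def, smul_eq_mul]
        rfl }
    b := (LinearMap.id : X.W →ₗ[k] X.W)
    comm := fun v => by
      change pullbackIso X ((1 : PerfectClosure L p) ⊗ₜ[L] ((1 : L) ⊗ₜ[K] v)) =
        TensorProduct.map (perfMap p f).toLinearMap (LinearMap.id : X.W →ₗ[k] X.W) _
      simp only [pullbackIso, LinearEquiv.trans_apply, AlgebraTensorModule.cancelBaseChange_tmul,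
        AlgebraTensorModule.cancelBaseChange_symm_tmul, one_smul, LinearEquiv.baseChange_tmul]
      generalize X.ψ (1 ⊗ₜ v) = z
      induction z with
      | zero => simp
      | add x y hx hy => simp only [map_add, TensorProduct.tmul_add, hx, hy]
      | tmul c w =>
        rw [AlgebraTensorModule.cancelBaseChange_tmul, TensorProduct.map_tmul, Algebra.smul_def,
          mul_one]
        rfl }

/-- A morphism over `f` factors through the pullback. -/
theorem SemiHom.exists_lift {f : K →ₐ[k] L} {X : Triple p k K} {Y : Triple p k L}
    (h : SemiHom f X Y) :
    ∃ h' : X.pullback f ⟶ Y, ∀ w : X.W, h'.b ((SemiHom.toPullback f X).b w) = h.b w := by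
  let _ : Algebra K L := f.toRingHom.toAlgebra
  let _ : Algebra (PerfectClosure K p) (PerfectClosure L p) := (perfMap p f).toRingHom.toAlgebra
  have : IsScalarTower K (PerfectClosure K p) (PerfectClosure L p) :=
    IsScalarTower.of_algebraMap_eq fun x => (perfMap_of p f x).symm
  have : IsScalarTower k (PerfectClosure K p) (PerfectClosure L p) :=
    IsScalarTower.of_algebraMap_eq fun x => ((perfMap p f).commutes x).symm
  let _ : Module K Y.V := Module.compHom Y.V (f : K →+* L)
  have : IsScalarTower K L Y.V := ⟨fun c l y => by
    rw [Algebra.smul_def, mul_smul]; rfl⟩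
  let a₀ : X.V →ₗ[K] Y.V :=
    { toFun := h.a, map_add' := h.a.map_add, map_smul' := fun c v => h.a.map_smulₛₗ c v }
  let a₁ : L ⊗[K] X.V →ₗ[L] Y.V := LinearMap.liftBaseChange L a₀
  refine ⟨⟨a₁, h.b, ?_⟩, fun w => rfl⟩
  intro z
  let b₁ : X.W →ₗ[k] Y.W := h.b
  have key : ∀ z : PerfectClosure L p ⊗[L] (L ⊗[K] X.V),
      Y.ψ (a₁.baseChange (PerfectClosure L p) z) =
      b₁.baseChange (PerfectClosure L p) (pullbackIso X z) := by
    intro z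
    induction z with
    | zero => simp
    | add x y hx hy => simp only [map_add, hx, hy]
    | tmul c t =>
      induction t with
      | zero => simp
      | add x y hx hy => simp only [map_add, TensorProduct.tmul_add, hx, hy]
      | tmul l v =>
        have e : c ⊗ₜ[L] (l ⊗ₜ[K] v) =
            (l • c) • ((1 : PerfectClosure L p) ⊗ₜ[L] ((1 : L) ⊗ₜ[K] v)) := by
          rw [TensorProduct.smul_tmul', smul_eq_mul, mul_one, TensorProduct.smul_tmul,
            TensorProduct.smul_tmul', smul_eq_mul, mul_one]
        have e2 : pullbackIso X ((1 : PerfectClosure L p) ⊗ₜ[L] ((1 : L) ⊗ₜ[K] v)) =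
          TensorProduct.map (perfMap p f).toLinearMap (LinearMap.id : X.W →ₗ[k] X.W)
            (X.ψ (1 ⊗ₜ v)) := (SemiHom.toPullback f X).comm v
        rw [e]
        simp only [map_smul]
        rw [e2, LinearMap.baseChange_tmul, LinearMap.liftBaseChange_tmul, one_smul]
        congr 1
        refine (h.comm v).trans ?_
        generalize X.ψ (1 ⊗ₜ v) = z
        induction z with
        | zero => simp
        | add x y hx hy => simp only [map_add, hx, hy]
        | tmul c w => simp [b₁]
  exact key z

/-- Composition of a morphism of triples with a morphism over `f`. -/
def SemiHom.precomp {f : K →ₐ[k] L} {X X' : Triple p k K} {Y : Triple p k L} (m : X ⟶ X')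
    (h : SemiHom f X' Y) : SemiHom f X Y where
  a := h.a.comp m.a
  b := h.b ∘ₗ m.b
  comm v := by
    have := m.comm (1 ⊗ₜ v)
    rw [LinearMap.baseChange_tmul] at this
    rw [LinearMap.comp_apply, h.comm, this]
    generalize X.ψ (1 ⊗ₜ v) = z
    induction z with
    | zero => simp
    | add x y hx hy => simp only [map_add, hx, hy]
    | tmul c w => simp

/-- Composition of morphisms over `f` and over `g`. -/
def SemiHom.comp {f : K →ₐ[k] L} {g : L →ₐ[k] M} {X : Triple p k K} {Y : Triple p k L}
    {Z : Triple p k M} (h : SemiHom f X Y) (h' : SemiHom g Y Z) : SemiHom (g.comp f) X Z where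
  a :=
    { toFun := fun v => h'.a (h.a v)
      map_add' := fun v w => by simp only [map_add]
      map_smul' := fun c v => by rw [h.a.map_smulₛₗ, h'.a.map_smulₛₗ]; rfl }
  b := h'.b ∘ₗ h.b
  comm v := by
    have : Z.ψ (1 ⊗ₜ h'.a (h.a v)) = _ := (h'.comm (h.a v)).trans (by rw [h.comm v])
    refine this.trans ?_
    generalize X.ψ (1 ⊗ₜ v) = z
    induction z with
    | zero => simp
    | add x y hx hy => simp only [map_add, hx, hy]
    | tmul c w => simp [perfMap_comp]

/-- The identity as a morphism over the identity. -/
def SemiHom.id (X : Triple p k K) : SemiHom (AlgHom.id k K) X X where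
  a := { toFun := fun v => v, map_add' := fun _ _ => rfl, map_smul' := fun _ _ => rfl }
  b := LinearMap.id
  comm v := by
    rw [perfMap_id]
    change X.ψ (1 ⊗ₜ v) = TensorProduct.map LinearMap.id LinearMap.id (X.ψ (1 ⊗ₜ v))
    simp

/-- Tensor product of morphisms over `f`. -/
def SemiHom.tensor {f : K →ₐ[k] L} {X X' : Triple p k K} {Y Y' : Triple p k L}
    (h : SemiHom f X Y) (h' : SemiHom f X' Y') : SemiHom f (X.tensor X') (Y.tensor Y') where
  a := TensorProduct.map h.a h'.a
  b := TensorProduct.map h.b h'.b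
  comm v := by
    let P := PerfectClosure K p
    let Q := PerfectClosure L p
    have key : ∀ (z : P ⊗[k] X.W) (z' : P ⊗[k] X'.W),
        (AlgebraTensorModule.distribBaseChange k Q Y.W Y'.W).symm
          (TensorProduct.map (perfMap p f).toLinearMap h.b z ⊗ₜ[Q]
            TensorProduct.map (perfMap p f).toLinearMap h'.b z') =
        TensorProduct.map (perfMap p f).toLinearMap (TensorProduct.map h.b h'.b)
          ((AlgebraTensorModule.distribBaseChange k P X.W X'.W).symm (z ⊗ₜ[P] z')) := by
      intro z z'
      induction z with
      | zero => simp
      | add x y hx hy => simp only [map_add, TensorProduct.add_tmul, hx, hy]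
      | tmul c w =>
        induction z' with
        | zero => simp
        | add x y hx hy => simp only [map_add, TensorProduct.tmul_add, hx, hy]
        | tmul c' w' => simp [AlgebraTensorModule.distribBaseChange_symm_tmul]
    have d : ∀ (A B C D : Type u) [Field A] [CommRing B] [Algebra A B] [AddCommGroup C]
        [Module A C] [AddCommGroup D] [Module A D] (c : C) (e : D),
        AlgebraTensorModule.distribBaseChange A B C D (1 ⊗ₜ (c ⊗ₜ e)) =
          ((1 : B) ⊗ₜ[A] c) ⊗ₜ[B] ((1 : B) ⊗ₜ[A] e) := by
      intro A B C D _ _ _ _ _ _ _ c e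
      rw [← LinearEquiv.eq_symm_apply, AlgebraTensorModule.distribBaseChange_symm_tmul, one_mul]
    have main : ∀ v : X.V ⊗[K] X'.V, (AlgebraTensorModule.distribBaseChange k Q Y.W Y'.W).symm
          (TensorProduct.congr Y.ψ Y'.ψ
            (AlgebraTensorModule.distribBaseChange L Q Y.V Y'.V
              (1 ⊗ₜ (TensorProduct.map h.a h'.a v)))) =
        TensorProduct.map (perfMap p f).toLinearMap (TensorProduct.map h.b h'.b)
          ((AlgebraTensorModule.distribBaseChange k P X.W X'.W).symm
            (TensorProduct.congr X.ψ X'.ψ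
              (AlgebraTensorModule.distribBaseChange K P X.V X'.V (1 ⊗ₜ v)))) := by
      intro v
      induction v with
      | zero => simp
      | add x y hx hy => simp only [map_add, TensorProduct.tmul_add, hx, hy]
      | tmul v v' =>
        rw [TensorProduct.map_tmul, d, d, TensorProduct.congr_tmul, TensorProduct.congr_tmul,
          h.comm, h'.comm, key]
    exact main v

variable (p) in
/-- The canonical morphism between the unit triples. -/
def SemiHom.unit (f : K →ₐ[k] L) : SemiHom f (Triple.unit p k K) (Triple.unit p k L) where
  a :=
    { toFun := fun x => f x
      map_add' := fun x y => map_add f x y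
      map_smul' := fun c x => map_mul f c x }
  b := (LinearMap.id : k →ₗ[k] k)
  comm v := by
    have main : ∀ v : K, (AlgebraTensorModule.rid k (PerfectClosure L p) (PerfectClosure L p)).symm
        (AlgebraTensorModule.rid L (PerfectClosure L p) (PerfectClosure L p) (1 ⊗ₜ f v)) =
      TensorProduct.map (perfMap p f).toLinearMap (LinearMap.id : k →ₗ[k] k)
        ((AlgebraTensorModule.rid k (PerfectClosure K p) (PerfectClosure K p)).symm
          (AlgebraTensorModule.rid K (PerfectClosure K p) (PerfectClosure K p) (1 ⊗ₜ v))) := by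
      intro v
      rw [AlgebraTensorModule.rid_tmul, AlgebraTensorModule.rid_tmul,
        AlgebraTensorModule.rid_symm_apply, AlgebraTensorModule.rid_symm_apply,
        TensorProduct.map_tmul, Algebra.smul_def, Algebra.smul_def, mul_one, mul_one,
        algebraMap_perf, algebraMap_perf, AlgHom.toLinearMap_apply]
      exact congrArg (· ⊗ₜ[k] (1 : k)) (perfMap_of p f v).symm
    exact main v

/-- The restriction of a family of automorphisms along the pullback functor. -/
def resFamily (f : K →ₐ[k] L) {R : Type u} [CommRing R] [Algebra k R]
    (g : ∀ Y : Triple p k L, (Module.End R (R ⊗[k] Y.W))ˣ) (X : Triple p k K) :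
    (Module.End R (R ⊗[k] X.W))ˣ :=
  g (X.pullback f)

theorem toPullback_baseChange (f : K →ₐ[k] L) {R : Type u} [CommRing R] [Algebra k R]
    (X : Triple p k K) (z : R ⊗[k] X.W) :
    (SemiHom.toPullback f X).b.baseChange R z = z := by
  change (LinearMap.id : X.W →ₗ[k] X.W).baseChange R z = z
  rw [LinearMap.baseChange_id]; rfl

/-- The restriction of a tensor automorphism is natural for morphisms over `f`. -/
theorem resFamily_natural {f : K →ₐ[k] L} {R : Type u} [CommRing R] [Algebra k R]
    {g : ∀ Y : Triple p k L, (Module.End R (R ⊗[k] Y.W))ˣ} (hg : IsTensorAut p k L R g)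
    {X : Triple p k K} {Y : Triple p k L} (h : SemiHom f X Y) (z : R ⊗[k] X.W) :
    (g Y).val (h.b.baseChange R z) = h.b.baseChange R ((resFamily f g X).val z) := by
  obtain ⟨h', hh⟩ := h.exists_lift
  have e : h.b = h'.b ∘ₗ (SemiHom.toPullback f X).b := LinearMap.ext fun w => (hh w).symm
  rw [e, LinearMap.baseChange_comp, LinearMap.comp_apply, LinearMap.comp_apply, hg.natural,
    toPullback_baseChange, toPullback_baseChange]
  rfl

theorem baseChange_tensorIso {f : K →ₐ[k] L} {R : Type u} [CommRing R] [Algebra k R]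
    {X X' : Triple p k K} {Y Y' : Triple p k L} (h : SemiHom f X Y) (h' : SemiHom f X' Y')
    (z : R ⊗[k] X.W) (z' : R ⊗[k] X'.W) :
    (h.tensor h').b.baseChange R (tensorIso R X X' (z ⊗ₜ z')) =
      tensorIso R Y Y' (h.b.baseChange R z ⊗ₜ h'.b.baseChange R z') := by
  change (TensorProduct.map h.b h'.b).baseChange R
      ((AlgebraTensorModule.distribBaseChange k R X.W X'.W).symm (z ⊗ₜ z')) =
    (AlgebraTensorModule.distribBaseChange k R Y.W Y'.W).symm
      (h.b.baseChange R z ⊗ₜ h'.b.baseChange R z')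
  induction z with
  | zero => simp
  | add x y hx hy => simp only [map_add, TensorProduct.add_tmul, hx, hy]
  | tmul c w =>
    induction z' with
    | zero => simp
    | add x y hx hy => simp only [map_add, TensorProduct.tmul_add, hx, hy]
    | tmul c' w' => simp [AlgebraTensorModule.distribBaseChange_symm_tmul]

theorem isTensorAut_resFamily (f : K →ₐ[k] L) {R : Type u} [CommRing R] [Algebra k R]
    {g : ∀ Y : Triple p k L, (Module.End R (R ⊗[k] Y.W))ˣ} (hg : IsTensorAut p k L R g) :
    IsTensorAut p k K R (resFamily f g) := by
  refine ⟨fun {X Y} m z => ?_, fun X Y z z' => ?_, fun z => ?_⟩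
  · have := resFamily_natural hg (SemiHom.precomp m (SemiHom.toPullback f Y)) z
    simp only [SemiHom.precomp, LinearMap.baseChange_comp, LinearMap.comp_apply,
      toPullback_baseChange] at this
    exact this
  · let t := (SemiHom.toPullback f X).tensor (SemiHom.toPullback f Y)
    have inj : Function.Injective (t.b.baseChange R) := by
      have : t.b = (LinearMap.id : X.W ⊗[k] Y.W →ₗ[k] X.W ⊗[k] Y.W) := by
        change TensorProduct.map (LinearMap.id : X.W →ₗ[k] X.W)
          (LinearMap.id : Y.W →ₗ[k] Y.W) = _
        exact TensorProduct.map_id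
      rw [this]
      erw [LinearMap.baseChange_id]
      exact fun _ _ h => h
    apply inj
    rw [← resFamily_natural hg t, baseChange_tensorIso, baseChange_tensorIso, hg.tensor,
      toPullback_baseChange, toPullback_baseChange, toPullback_baseChange, toPullback_baseChange]
    rfl
  · have := resFamily_natural hg (SemiHom.unit p f) z
    rw [hg.unit] at this
    have h2 : ∀ z : R ⊗[k] (Triple.unit p k K).W, (SemiHom.unit p f).b.baseChange R z = z := by
      intro z
      change (LinearMap.id : k →ₗ[k] k).baseChange R z = z
      rw [LinearMap.baseChange_id]; rfl
    rw [h2, h2] at this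
    exact this.symm

variable (p) in
/-- Restriction of tensor automorphisms along `f : K → L`. -/
def res (f : K →ₐ[k] L) (R : Type u) [CommRing R] [Algebra k R] :
    tensorAut p k L R →* tensorAut p k K R where
  toFun g := ⟨resFamily f g.1, isTensorAut_resFamily f g.2⟩
  map_one' := rfl
  map_mul' _ _ := rfl

theorem res_id (R : Type u) [CommRing R] [Algebra k R] (g : tensorAut p k K R) :
    res p (AlgHom.id k K) R g = g := by
  refine Subtype.ext (funext fun X => Units.ext (LinearMap.ext fun z => ?_))
  have := resFamily_natural g.2 (SemiHom.id X) z
  simp only [SemiHom.id, LinearMap.baseChange_id, LinearMap.id_apply] at this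
  exact this.symm

theorem res_comp (g : L →ₐ[k] M) (f : K →ₐ[k] L) (R : Type u) [CommRing R] [Algebra k R]
    (t : tensorAut p k M R) : res p (g.comp f) R t = res p f R (res p g R t) := by
  refine Subtype.ext (funext fun X => Units.ext (LinearMap.ext fun z => ?_))
  have := resFamily_natural t.2
    ((SemiHom.toPullback f X).comp (SemiHom.toPullback g (X.pullback f))) z
  have e : ∀ z : R ⊗[k] X.W, ((SemiHom.toPullback f X).comp
      (SemiHom.toPullback g (X.pullback f))).b.baseChange R z = z := by
    intro z
    change (LinearMap.id ∘ₗ LinearMap.id : X.W →ₗ[k] X.W).baseChange R z = z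
    rw [LinearMap.comp_id, LinearMap.baseChange_id]; rfl
  rw [e, e] at this
  exact this.symm

end Pullback

/-! ### Representability of the functor of tensor automorphisms -/

section Representable

variable (p : ℕ) [Fact p.Prime] (k K : Type u) [Field k] [Field K] [CharP K p] [Algebra k K]

/-- The functor `R ↦ Aut^⊗((V, W, ψ) ↦ R ⊗ W)` from `k`-algebras to groups. -/
def autFunctor : CommAlgCat.{u} k ⥤ GrpCat.{u + 1} where
  obj R := GrpCat.of (tensorAut p k K R)
  map f := GrpCat.ofHom (tensorAutMap p k K f.hom)
  map_id R := by
    refine GrpCat.hom_ext (MonoidHom.ext fun g => ?_)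
    refine Subtype.ext (funext fun X => Units.ext ?_)
    refine end_ext_coeffMap X.W (AlgHom.id k R) fun z => ?_
    have e : ∀ z : R ⊗[k] X.W, coeffMap X.W (AlgHom.id k R) z = z := fun z =>
      LinearMap.rTensor_id_apply _ _ z
    exact (coeffMap_units (AlgHom.id k R) X.W (g.1 X) z).trans (by rw [e, e]; rfl)
  map_comp {R S T} f h := by
    refine GrpCat.hom_ext (MonoidHom.ext fun g => ?_)
    refine Subtype.ext (funext fun X => Units.ext ?_)
    refine end_ext_coeffMap X.W (h.hom.comp f.hom) fun z => ?_
    refine (coeffMap_units (h.hom.comp f.hom) X.W (g.1 X) z).trans ?_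
    rw [coeffMap_comp_apply, coeffMap_comp_apply]
    refine Eq.trans ?_ (coeffMap_units h.hom X.W _ (coeffMap X.W f.hom z)).symm
    exact congrArg _ (coeffMap_units f.hom X.W (g.1 X) z).symm

/-- Matrices over the perfect closure: every triple is determined up to isomorphism by one. -/
abbrev Code : Type u := Σ n m : ℕ, Matrix (Fin m) (Fin n) (PerfectClosure K p)

variable {p k K}

/-- The matrix `c` describes the triple `X` in suitable bases. -/
def HasCode (X : Triple p k K) (c : Code p K) : Prop :=
  ∃ (bV : Module.Basis (Fin c.1) K X.V) (bW : Module.Basis (Fin c.2.1) k X.W),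
    ∀ j, X.ψ (1 ⊗ₜ bV j) = ∑ i, c.2.2 i j ⊗ₜ bW i

theorem exists_code (X : Triple p k K) : ∃ c, HasCode X c := by
  let bV := Module.finBasis K X.V
  let bW := Module.finBasis k X.W
  refine ⟨⟨_, _, fun i j => (bW.baseChange (PerfectClosure K p)).repr (X.ψ (1 ⊗ₜ bV j)) i⟩,
    bV, bW, fun j => ?_⟩
  conv_lhs => rw [← (bW.baseChange (PerfectClosure K p)).sum_repr (X.ψ (1 ⊗ₜ bV j))]
  refine Finset.sum_congr rfl fun i _ => ?_
  rw [Module.Basis.baseChange_apply, TensorProduct.smul_tmul', smul_eq_mul, mul_one]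

theorem HasCode.exists_hom {X Y : Triple p k K} {c : Code p K} (hX : HasCode X c)
    (hY : HasCode Y c) : ∃ (f : X ⟶ Y) (g : Y ⟶ X), (∀ w, g.b (f.b w) = w) ∧
      ∀ w, f.b (g.b w) = w := by
  obtain ⟨bV, bW, h⟩ := hX
  obtain ⟨bV', bW', h'⟩ := hY
  have aux : ∀ {X Y : Triple p k K} (bV : Module.Basis (Fin c.1) K X.V)
      (bW : Module.Basis (Fin c.2.1) k X.W) (bV' : Module.Basis (Fin c.1) K Y.V)
      (bW' : Module.Basis (Fin c.2.1) k Y.W)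
      (_ : ∀ j, X.ψ (1 ⊗ₜ bV j) = ∑ i, c.2.2 i j ⊗ₜ bW i)
      (_ : ∀ j, Y.ψ (1 ⊗ₜ bV' j) = ∑ i, c.2.2 i j ⊗ₜ bW' i) (z),
      Y.ψ ((bV.equiv bV' (Equiv.refl _)).toLinearMap.baseChange (PerfectClosure K p) z) =
        (bW.equiv bW' (Equiv.refl _)).toLinearMap.baseChange (PerfectClosure K p) (X.ψ z) := by
    intro X Y bV bW bV' bW' h h' z
    suffices e : Y.ψ.toLinearMap ∘ₗ
        (bV.equiv bV' (Equiv.refl _)).toLinearMap.baseChange (PerfectClosure K p) =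
        (bW.equiv bW' (Equiv.refl _)).toLinearMap.baseChange (PerfectClosure K p) ∘ₗ
          X.ψ.toLinearMap from LinearMap.congr_fun e z
    refine (bV.baseChange (PerfectClosure K p)).ext fun j => ?_
    simp [h, h', Module.Basis.equiv_apply]
  refine ⟨⟨(bV.equiv bV' (Equiv.refl _)).toLinearMap, (bW.equiv bW' (Equiv.refl _)).toLinearMap,
    aux bV bW bV' bW' h h'⟩, ⟨(bV'.equiv bV (Equiv.refl _)).toLinearMap,
      (bW'.equiv bW (Equiv.refl _)).toLinearMap, aux bV' bW' bV bW h' h⟩, fun w => ?_, fun w => ?_⟩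
  · exact (bW.equiv bW' (Equiv.refl _)).symm_apply_apply w
  · exact (bW.equiv bW' (Equiv.refl _)).apply_symm_apply w

open Classical in
/-- A triple with the given code, if there is one. -/
def rep (c : Code p K) : Triple p k K :=
  if h : ∃ X : Triple p k K, HasCode X c then h.choose else Triple.unit p k K

theorem exists_rep (X : Triple p k K) : ∃ (c : Code p K) (f : X ⟶ rep c) (g : rep c ⟶ X),
    (∀ w, g.b (f.b w) = w) ∧ ∀ w, f.b (g.b w) = w := by
  obtain ⟨c, hc⟩ := exists_code X
  have h : ∃ X : Triple p k K, HasCode X c := ⟨X, hc⟩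
  have : HasCode (rep (k := k) c) c := by rw [rep, dif_pos h]; exact h.choose_spec
  exact ⟨c, hc.exists_hom this⟩

/-- The chosen basis of the fibre of `rep c`. -/
abbrev repBasis (c : Code p K) := Module.finBasis k (rep (k := k) c).W

variable (p k K) in
/-- The matrix coefficients on the triples `rep c`, of an automorphism and of its inverse. -/
abbrev Coeff : Type u := Σ c : Code p K, Bool ×
  (Fin (Module.finrank k (rep (k := k) c).W) × Fin (Module.finrank k (rep (k := k) c).W))

/-- An automorphism or its inverse. -/
def signed {R : Type u} [CommRing R] [Algebra k R] (g : tensorAut p k K R) (s : Bool) :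
    tensorAut p k K R := if s then g else g⁻¹

/-- The matrix coefficients of a tensor automorphism. -/
def point {R : Type u} [CommRing R] [Algebra k R] (g : tensorAut p k K R) (x : Coeff p k K) : R :=
  ((repBasis x.1).baseChange R).repr
    (((signed g x.2.1).1 (rep x.1)).val (1 ⊗ₜ repBasis x.1 x.2.2.2)) x.2.2.1

variable (p k K) in
/-- The polynomials in the matrix coefficients that vanish on all tensor automorphisms. -/
def coordIdeal : Ideal (MvPolynomial (Coeff p k K) k) :=
  ⨅ (R : CommAlgCat.{u} k) (g : tensorAut p k K R),
    RingHom.ker (MvPolynomial.aeval (R := k) (point g))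

variable (p k K) in
/-- The coordinate ring of the group scheme of tensor automorphisms. -/
abbrev CoordRing : Type u := MvPolynomial (Coeff p k K) k ⧸ coordIdeal p k K

/-- Evaluation of coordinate functions at a tensor automorphism. -/
def evalAt (R : CommAlgCat.{u} k) (g : tensorAut p k K R) : CoordRing p k K →ₐ[k] R :=
  Ideal.Quotient.liftₐ _ (MvPolynomial.aeval (R := k) (point g)) fun _ hx =>
    (Submodule.mem_iInf _).1 ((Submodule.mem_iInf _).1 hx R) g

theorem evalAt_mk (R : CommAlgCat.{u} k) (g : tensorAut p k K R) (x) :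
    evalAt R g (Ideal.Quotient.mk _ x) = MvPolynomial.aeval (R := k) (point g) x := rfl

theorem coordRing_ext {x y : CoordRing p k K}
    (h : ∀ (R : CommAlgCat.{u} k) (g : tensorAut p k K R), evalAt R g x = evalAt R g y) :
    x = y := by
  obtain ⟨x, rfl⟩ := Ideal.Quotient.mk_surjective x
  obtain ⟨y, rfl⟩ := Ideal.Quotient.mk_surjective y
  refine Ideal.Quotient.eq.2 ?_
  refine (Submodule.mem_iInf _).2 fun R => (Submodule.mem_iInf _).2 fun g => ?_
  have := h R g
  rw [evalAt_mk, evalAt_mk] at this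
  exact RingHom.mem_ker.2 (by rw [map_sub, this, sub_self])

theorem repr_coeffMap {R S W ι : Type*} [CommRing R] [Algebra k R] [CommRing S] [Algebra k S]
    [AddCommGroup W] [Module k W] (b : Module.Basis ι k W) (f : R →ₐ[k] S) (z : R ⊗[k] W) (i : ι) :
    (b.baseChange S).repr (f.toLinearMap.rTensor W z) i = f ((b.baseChange R).repr z i) := by
  induction z with
  | zero => simp
  | add x y hx hy => simp only [map_add, Finsupp.add_apply, hx, hy]
  | tmul a w => simp [Module.Basis.baseChange_repr_tmul]

theorem coordRing_tensor_ext {W : Type u} [AddCommGroup W] [Module k W] [FiniteDimensional k W]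
    {x y : CoordRing p k K ⊗[k] W}
    (h : ∀ (R : CommAlgCat.{u} k) (g : tensorAut p k K R),
      coeffMap W (evalAt R g) x = coeffMap W (evalAt R g) y) : x = y := by
  let b := Module.finBasis k W
  refine (b.baseChange (CoordRing p k K)).repr.injective (Finsupp.ext fun i => ?_)
  refine coordRing_ext fun R g => ?_
  rw [← repr_coeffMap, ← repr_coeffMap, h]

/-- The universal matrix on `rep c`. -/
def univEnd (c : Code p K) (s : Bool) :
    Module.End (CoordRing p k K) (CoordRing p k K ⊗[k] (rep (k := k) c).W) :=
  ((repBasis c).baseChange (CoordRing p k K)).constr (CoordRing p k K) fun j =>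
    ∑ i, Ideal.Quotient.mk (coordIdeal p k K) (MvPolynomial.X ⟨c, s, i, j⟩) ⊗ₜ[k] repBasis c i

theorem univEnd_basis (c : Code p K) (s : Bool) (j) :
    univEnd (k := k) c s (1 ⊗ₜ repBasis c j) =
      ∑ i, Ideal.Quotient.mk (coordIdeal p k K) (MvPolynomial.X ⟨c, s, i, j⟩) ⊗ₜ[k]
        repBasis c i := by
  rw [← Module.Basis.baseChange_apply, univEnd, Module.Basis.constr_basis]

theorem eval_univEnd (c : Code p K) (s : Bool) (R : CommAlgCat.{u} k) (g : tensorAut p k K R)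
    (z : CoordRing p k K ⊗[k] (rep (k := k) c).W) :
    coeffMap _ (evalAt R g) (univEnd c s z) =
      ((signed g s).1 (rep c)).val (coeffMap _ (evalAt R g) z) := by
  suffices h : pushEnd _ (evalAt R g) (univEnd c s) = ((signed g s).1 (rep c)).val by
    rw [← h, pushEnd_coeffMap]
  refine ((repBasis c).baseChange R).ext fun j => ?_
  have e : ((repBasis c).baseChange R) j =
      coeffMap _ (evalAt R g) ((1 : CoordRing p k K) ⊗ₜ repBasis c j) := by
    rw [Module.Basis.baseChange_apply, coeffMap, LinearMap.rTensor_tmul, AlgHom.toLinearMap_apply,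
      map_one]
  rw [e, pushEnd_coeffMap, univEnd_basis, ← e, map_sum,
    ← ((repBasis c).baseChange R).sum_repr (((signed g s).1 (rep c)).val _)]
  refine Finset.sum_congr rfl fun i _ => ?_
  rw [coeffMap, LinearMap.rTensor_tmul, AlgHom.toLinearMap_apply, evalAt_mk, MvPolynomial.aeval_X,
    Module.Basis.baseChange_apply, Module.Basis.baseChange_apply, TensorProduct.smul_tmul',
    smul_eq_mul, mul_one]
  rfl

/-- The universal endomorphism (or its inverse) on the fibre of a triple. -/
def univAt (X : Triple p k K) (s : Bool) :
    Module.End (CoordRing p k K) (CoordRing p k K ⊗[k] X.W) :=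
  (exists_rep X).choose_spec.choose_spec.choose.b.baseChange (CoordRing p k K) ∘ₗ
    univEnd (exists_rep X).choose s ∘ₗ
    (exists_rep X).choose_spec.choose.b.baseChange (CoordRing p k K)

theorem eval_univAt (X : Triple p k K) (s : Bool) (R : CommAlgCat.{u} k) (g : tensorAut p k K R)
    (z : CoordRing p k K ⊗[k] X.W) :
    coeffMap _ (evalAt R g) (univAt X s z) =
      ((signed g s).1 X).val (coeffMap _ (evalAt R g) z) := by
  have h := (exists_rep X).choose_spec.choose_spec.choose_spec.1
  have hg : IsTensorAut p k K R (signed g s).1 := (signed g s).2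
  rw [univAt, LinearMap.comp_apply, LinearMap.comp_apply, coeffMap_baseChange, eval_univEnd,
    coeffMap_baseChange, ← hg.natural]
  generalize coeffMap _ (evalAt R g) z = y
  rw [← LinearMap.comp_apply (LinearMap.baseChange _ _), ← LinearMap.baseChange_comp]
  have e : (exists_rep X).choose_spec.choose_spec.choose.b ∘ₗ (exists_rep X).choose_spec.choose.b =
    LinearMap.id := LinearMap.ext h
  rw [e, LinearMap.baseChange_id]; rfl

variable (p k K) in
/-- The universal tensor automorphism. -/
def univAut : tensorAut p k K (CoordRing p k K) :=
  ⟨fun X =>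
    { val := univAt X true
      inv := univAt X false
      val_inv := LinearMap.ext fun z => coordRing_tensor_ext fun R g => by
        rw [Module.End.mul_apply, eval_univAt, eval_univAt]
        change ((g.1 X) * (g.1 X)⁻¹).val _ = _
        rw [mul_inv_cancel]; rfl
      inv_val := LinearMap.ext fun z => coordRing_tensor_ext fun R g => by
        rw [Module.End.mul_apply, eval_univAt, eval_univAt]
        change ((g.1 X)⁻¹ * (g.1 X)).val _ = _
        rw [inv_mul_cancel]; rfl },
    { natural := fun {X Y} f z => coordRing_tensor_ext fun R g => by
        have hg : IsTensorAut p k K R (signed g true).1 := (signed g true).2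
        rw [eval_univAt, coeffMap_baseChange, coeffMap_baseChange, eval_univAt, hg.natural]
      tensor := fun X Y z z' => coordRing_tensor_ext fun R g => by
        have hg : IsTensorAut p k K R (signed g true).1 := (signed g true).2
        rw [eval_univAt, coeffMap_tensorIso, coeffMap_tensorIso, eval_univAt, eval_univAt,
          hg.tensor]
      unit := fun z => coordRing_tensor_ext fun R g => by
        have hg : IsTensorAut p k K R (signed g true).1 := (signed g true).2
        rw [eval_univAt, hg.unit] }⟩

theorem map_evalAt (R : CommAlgCat.{u} k) (g : tensorAut p k K R) :
    tensorAutMap p k K (evalAt R g) (univAut p k K) = g := by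
  refine Subtype.ext (funext fun X => Units.ext ?_)
  refine end_ext_coeffMap X.W (evalAt R g) fun z => ?_
  exact (coeffMap_units (evalAt R g) X.W _ z).trans (eval_univAt X true R g z)

theorem univAut_signed (c : Code p K) (s : Bool) :
    ((signed (univAut p k K) s).1 (rep c)).val = univEnd c s := by
  refine LinearMap.ext fun z => coordRing_tensor_ext fun R g => ?_
  rw [eval_univEnd, ← eval_univAt]
  cases s <;> rfl

theorem evalAt_map (R : CommAlgCat.{u} k) (f : CoordRing p k K →ₐ[k] R) :
    evalAt R (tensorAutMap p k K f (univAut p k K)) = f := by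
  refine Ideal.Quotient.algHom_ext _ (MvPolynomial.algHom_ext fun x => ?_)
  obtain ⟨c, s, i, j⟩ := x
  change MvPolynomial.aeval (R := k) (point _) (MvPolynomial.X _) = f (Ideal.Quotient.mk _ _)
  rw [MvPolynomial.aeval_X, point]
  have e1 : signed (tensorAutMap p k K f (univAut p k K)) s =
      tensorAutMap p k K f (signed (univAut p k K) s) := by
    cases s
    · exact (map_inv _ _).symm
    · rfl
  have e2 : (1 : R) ⊗ₜ[k] repBasis c j =
      coeffMap _ f ((1 : CoordRing p k K) ⊗ₜ repBasis c j) := by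
    rw [coeffMap, LinearMap.rTensor_tmul, AlgHom.toLinearMap_apply, map_one]
  have e3 := coeffMap_units f _ ((signed (univAut p k K) s).1 (rep c)) (1 ⊗ₜ repBasis c j)
  rw [univAut_signed, univEnd_basis] at e3
  dsimp only
  rw [e1, e2]
  refine (congrArg (fun y => ((repBasis c).baseChange R).repr y i) e3).trans ?_
  refine (repr_coeffMap (repBasis c) f _ i).trans (congrArg f ?_)
  rw [map_sum, Finset.sum_apply']
  simp [Module.Basis.baseChange_repr_tmul, Finsupp.single_apply]

variable (p k K) in
/-- The functor of tensor automorphisms is represented by the coordinate ring. -/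
def autRepresentable : (autFunctor p k K ⋙ forget GrpCat).CorepresentableBy
    (CommAlgCat.of k (CoordRing p k K)) where
  homEquiv {R} :=
    { toFun := fun f => tensorAutMap p k K f.hom (univAut p k K)
      invFun := fun g => CommAlgCat.ofHom (evalAt R g)
      left_inv := fun f => CommAlgCat.hom_ext (evalAt_map R f.hom)
      right_inv := fun g => map_evalAt R g }
  homEquiv_comp {R S} g f := by
    have := (autFunctor p k K).map_comp f g
    exact congrArg (fun h => h.hom (univAut p k K)) this

end Representable

/-! ### Affine group schemes -/

section GroupSchemes

variable (k : Type u) [Field k]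

/-- Affine group schemes over `k`: the functors from `k`-algebras to groups that are represented
by a `k`-algebra. (The values may be large, the representing algebra is small.) -/
abbrev AffineGroupScheme : Type (u + 2) :=
  ObjectProperty.FullSubcategory (C := CommAlgCat.{u} k ⥤ GrpCat.{u + 1}) fun G =>
    ∃ A : CommAlgCat.{u} k, Nonempty ((G ⋙ forget GrpCat).CorepresentableBy A)

variable {k}

/-- The `R`-valued points of an affine group scheme. -/
abbrev AffineGroupScheme.points (G : AffineGroupScheme k) (R : CommAlgCat.{u} k) :
    GrpCat.{u + 1} :=
  G.obj.obj R

/-- The algebra `A` is a coordinate ring of `G`. -/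
abbrev AffineGroupScheme.CoordinateRing (G : AffineGroupScheme k) (A : CommAlgCat.{u} k) :
    Type (u + 1) :=
  (G.obj ⋙ forget GrpCat).CorepresentableBy A

/-- The effect on `R`-valued points of a homomorphism of affine group schemes. -/
abbrev AffineGroupScheme.onPoints {G H : AffineGroupScheme k} (φ : G ⟶ H)
    (R : CommAlgCat.{u} k) : G.points R →* H.points R :=
  (φ.hom.app R).hom

/-- The homomorphism of coordinate rings attached to a homomorphism of affine group schemes:
the one that corresponds to the image of the universal point of `G`. -/
def AffineGroupScheme.comorphism {G H : AffineGroupScheme k} (φ : G ⟶ H)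
    {A B : CommAlgCat.{u} k} (a : G.CoordinateRing A) (b : H.CoordinateRing B) : B ⟶ A :=
  b.homEquiv.symm (AffineGroupScheme.onPoints φ A (a.homEquiv (𝟙 A)))

/-- A homomorphism of affine group schemes is a closed immersion if the homomorphism of
coordinate rings is surjective. -/
def AffineGroupScheme.IsClosedImmersion {G H : AffineGroupScheme k} (φ : G ⟶ H) : Prop :=
  ∀ (A B : CommAlgCat.{u} k) (a : G.CoordinateRing A) (b : H.CoordinateRing B),
    Function.Surjective (AffineGroupScheme.comorphism φ a b).hom

/-- Closed subgroup schemes of `G`: subgroups of `G(R)` for all `R`, functorial in `R`, which are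
cut out by an ideal of the coordinate ring. -/
@[ext]
structure AffineGroupScheme.ClosedSubgroup (G : AffineGroupScheme k) where
  carrier : ∀ R : CommAlgCat.{u} k, Subgroup (G.points R)
  map_mem : ∀ {R S : CommAlgCat.{u} k} (f : R ⟶ S) (g : G.points R), g ∈ carrier R →
    (G.obj.map f).hom g ∈ carrier S
  closed : ∀ (A : CommAlgCat.{u} k) (a : G.CoordinateRing A), ∃ I : Ideal A,
    ∀ (R : CommAlgCat.{u} k) (f : A ⟶ R), a.homEquiv f ∈ carrier R ↔ ∀ x ∈ I, f.hom x = 0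

/-- Closed subgroup schemes are ordered by inclusion. -/
instance (G : AffineGroupScheme k) : PartialOrder G.ClosedSubgroup where
  le H H' := ∀ R, H.carrier R ≤ H'.carrier R
  le_refl _ _ := le_rfl
  le_trans _ _ _ h h' R := (h R).trans (h' R)
  le_antisymm _ _ h h' :=
    AffineGroupScheme.ClosedSubgroup.ext (funext fun R => (h R).antisymm (h' R))

end GroupSchemes

/-! ### The local Nori fundamental group -/

section PiL

variable (p : ℕ) [Fact p.Prime]

/-- The local Nori fundamental group of `K/k`: the group scheme of tensor automorphisms of the
fibre functor `(V, W, ψ) ↦ W` on the category of triples. -/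
def piL (k K : Type u) [Field k] [Field K] [CharP K p] [Algebra k K] : AffineGroupScheme k :=
  ⟨autFunctor p k K, _, ⟨autRepresentable p k K⟩⟩

/-- The homomorphism of local Nori fundamental groups induced by a homomorphism of extensions
of `k`: restriction of tensor automorphisms along the pullback of triples. -/
def piLMap {k K L : Type u} [Field k] [Field K] [Field L] [CharP K p] [CharP L p] [Algebra k K]
    [Algebra k L] (f : K →ₐ[k] L) : piL p k L ⟶ piL p k K :=
  ObjectProperty.homMk
    { app := fun R => GrpCat.ofHom (res p f R)
      naturality := fun _ _ _ => rfl }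

theorem piLMap_id {k K : Type u} [Field k] [Field K] [CharP K p] [Algebra k K] :
    piLMap p (AlgHom.id k K) = 𝟙 (piL p k K) :=
  ObjectProperty.hom_ext _ (NatTrans.ext (funext fun R =>
    GrpCat.hom_ext (MonoidHom.ext fun g => res_id R g)))

theorem piLMap_comp {k K L M : Type u} [Field k] [Field K] [Field L] [Field M] [CharP K p]
    [CharP L p] [CharP M p] [Algebra k K] [Algebra k L] [Algebra k M]
    (g : L →ₐ[k] M) (f : K →ₐ[k] L) : piLMap p (g.comp f) = piLMap p g ≫ piLMap p f :=
  ObjectProperty.hom_ext _ (NatTrans.ext (funext fun R =>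
    GrpCat.hom_ext (MonoidHom.ext fun t => res_comp g f R t)))

end PiL

/-! ### Purely inseparable extensions -/

section PI

variable (k K : Type u) [Field k] [Field K] [Algebra k K]

/-- Purely inseparable extensions of `K`, with the `k`-algebra structure induced from `K`. -/
structure PI where
  carrier : Type u
  [field : Field carrier]
  [algebra : Algebra K carrier]
  [algebraBase : Algebra k carrier]
  [tower : IsScalarTower k K carrier]
  [purelyInseparable : IsPurelyInseparable K carrier]

variable {k K}

instance : CoeSort (PI k K) (Type u) := ⟨PI.carrier⟩

attribute [instance] PI.field PI.algebra PI.algebraBase PI.tower PI.purelyInseparable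

/-- The morphisms are the homomorphisms of extensions of `K`. -/
instance : Category (PI k K) where
  Hom L M := L →ₐ[K] M
  id L := AlgHom.id K L
  comp f g := g.comp f

instance : Quiver.IsThin (PI k K) := fun L M =>
  inferInstanceAs (Subsingleton (L →ₐ[K] M))

instance (p : ℕ) [CharP K p] (L : PI k K) : CharP L p :=
  charP_of_injective_algebraMap (algebraMap K L).injective p

/-- A homomorphism of extensions of `K`, as a homomorphism of extensions of `k`. -/
def PI.homBase {L M : PI k K} (f : L ⟶ M) : L →ₐ[k] M :=
  AlgHom.restrictScalars k (S := K) f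

theorem PI.homBase_id (L : PI k K) : PI.homBase (𝟙 L) = AlgHom.id k L := rfl

theorem PI.homBase_comp {L M N : PI k K} (f : L ⟶ M) (g : M ⟶ N) :
    PI.homBase (f ≫ g) = (PI.homBase g).comp (PI.homBase f) := rfl

theorem PI.homBase_comp_toAlgHom {L M : PI k K} (f : L ⟶ M) :
    (PI.homBase f).comp (IsScalarTower.toAlgHom k K L) = IsScalarTower.toAlgHom k K M :=
  AlgHom.ext fun x => AlgHom.commutes (R := K) f x

variable (p : ℕ) [Fact p.Prime] [CharP K p]

/-- The homomorphism `π(L/k) → π(K/k)` attached to a purely inseparable extension `L/K`. -/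
def PI.toBase (L : PI k K) : piL p k L ⟶ piL p k K :=
  piLMap p (IsScalarTower.toAlgHom k K L)

theorem PI.map_toBase {L M : PI k K} (f : L ⟶ M) :
    piLMap p (PI.homBase f) ≫ L.toBase p = M.toBase p := by
  rw [PI.toBase, PI.toBase, ← piLMap_comp, PI.homBase_comp_toAlgHom]

variable (k K)

/-- The contravariant functor `L ↦ (π(L/k) → π(K/k))` from purely inseparable extensions of `K`
to affine group schemes over `π(K/k)`. -/
def piFunctor : (PI k K)ᵒᵖ ⥤ Over (piL p k K) where
  obj L := Over.mk (L.unop.toBase p)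
  map f := Over.homMk (piLMap p (PI.homBase f.unop)) (PI.map_toBase p f.unop)
  map_id L := Over.OverMorphism.ext (piLMap_id (k := k) (K := L.unop) p)
  map_comp f g := Over.OverMorphism.ext
    (piLMap_comp p (PI.homBase f.unop) (PI.homBase g.unop))

end PI

end LocalNori

end

/-! Write `P` for the perfect closure. A triple over `K` is a `K`-structure `V` on the `P`-vector
space `P ⊗ W`, where `W` is a `k`-vector space. A purely inseparable extension `L` of `K` has the
same perfect closure as `K` (`perfMap_bijective`), so passing from `K` to `L` only coarsens the
structure.

Closed immersion. Given a triple over `L`, the `K`-span of an `L`-basis of `V` inside `P ⊗ W` is a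
triple over `K` whose pullback is the given one (`exists_semiHom_surjective`). Hence every matrix
coefficient of `π(L/k)` is the restriction of a function on `π(K/k)`, and the homomorphism of
coordinate rings is surjective (`evalAt_res_univAut_surjective`).

Recovering the field. For `t` in `P` let `Triple.shear k t` be `(K², k², ψ)` with `ψ` unipotent and
off-diagonal entry `t`. Put `w₀ = (1, 0)` and `w₁ = (0, 1)`. If `t` lies in `M`, then after pullback
to `M` the vector `w₁` comes from `V`, so `π(M/k)` fixes it (`IsTensorAut.fixed`). Conversely,
`π(L/k)` has a tautological point over `P ⊗_L P`, the descent datum `descentAut`: it compares the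
two extensions of `ψ` along the inclusions of the factors. It sends `w₁` to `w₁ + (t ⊗ 1 - 1 ⊗ t)
w₀`, so it fixes `w₁` only if `t ⊗ 1 = 1 ⊗ t`, that is, if `t` lies in `L`
(`exists_of_descentAut_fixed`). If `π(L/k)` is contained in `π(M/k)`, every `t` in `M` therefore
lies in `L`, which gives a `K`-homomorphism from `M` to `L` (`PI.exists_hom_of_range_le`).

Fullness follows: a homomorphism over `π(K/k)` forces an inclusion of images, hence a homomorphism
of fields, and it is the induced one because closed immersions are monomorphisms. Faithfulness holds
because `PI k K` is thin. -/

noncomputable section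

namespace LocalNori

/-! ### Points of the fundamental group attached to pairs of homomorphisms from `K^perf` -/

section Descent

variable {p : ℕ} [Fact p.Prime] {k K : Type u} [Field k] [Field K] [CharP K p] [Algebra k K]
  {S : Type u} [CommRing S] [Algebra k S] [Algebra K S] [IsScalarTower k K S]

/-- The extension of `ψ` along a homomorphism `q : K^perf → S` of `K`-algebras. -/
def Triple.extendFun (q : PerfectClosure K p →ₐ[K] S) (X : Triple p k K) :
    S ⊗[K] X.V →ₗ[S] S ⊗[k] X.W :=
  LinearMap.liftBaseChange S
    ({ toFun := fun v => coeffMap X.W (q.restrictScalars k) (X.ψ (1 ⊗ₜ v))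
       map_add' := fun v w => by rw [TensorProduct.tmul_add, map_add, map_add]
       map_smul' := fun c v => by
        have e : (1 : PerfectClosure K p) ⊗ₜ[K] (c • v) =
            algebraMap K (PerfectClosure K p) c • (1 ⊗ₜ[K] v) := by
          rw [algebraMap_smul, TensorProduct.tmul_smul]
        rw [e, map_smul, coeffMap_smul, AlgHom.restrictScalars_apply, AlgHom.commutes,
          algebraMap_smul, RingHom.id_apply] } : X.V →ₗ[K] S ⊗[k] X.W)

/-- The image of `K^perf ⊗ V` generates `S ⊗ V` over `S`, so this identity characterizes the
extension. The compatibilities of `Triple.extend` below are reduced to the corresponding facts about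
`ψ` through it. -/
theorem Triple.extendFun_coeffMap (q : PerfectClosure K p →ₐ[K] S) (X : Triple p k K)
    (z : PerfectClosure K p ⊗[K] X.V) :
    X.extendFun q (coeffMap X.V q z) = coeffMap X.W (q.restrictScalars k) (X.ψ z) := by
  induction z with
  | zero => simp
  | add x y hx hy => simp only [map_add, hx, hy]
  | tmul c v =>
    have e : c ⊗ₜ[K] v = c • ((1 : PerfectClosure K p) ⊗ₜ[K] v) := by
      simp [TensorProduct.smul_tmul']
    rw [e, coeffMap_smul, map_smul, map_smul, coeffMap_smul]
    simp [extendFun]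

/-- The inverse of `Triple.extendFun`. -/
def Triple.extendInv (q : PerfectClosure K p →ₐ[K] S) (X : Triple p k K) :
    S ⊗[k] X.W →ₗ[S] S ⊗[K] X.V :=
  LinearMap.liftBaseChange S
    ({ toFun := fun w => coeffMap X.V q (X.ψ.symm (1 ⊗ₜ w))
       map_add' := fun v w => by rw [TensorProduct.tmul_add, map_add, map_add]
       map_smul' := fun c w => by
        have e : (1 : PerfectClosure K p) ⊗ₜ[k] (c • w) =
            algebraMap k (PerfectClosure K p) c • (1 ⊗ₜ[k] w) := by
          rw [algebraMap_smul, TensorProduct.tmul_smul]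
        rw [e, map_smul, coeffMap_smul, IsScalarTower.algebraMap_apply k K (PerfectClosure K p),
          AlgHom.commutes, ← IsScalarTower.algebraMap_apply k K S, algebraMap_smul,
          RingHom.id_apply] } : X.W →ₗ[k] S ⊗[K] X.V)

theorem Triple.extendInv_coeffMap (q : PerfectClosure K p →ₐ[K] S) (X : Triple p k K)
    (z : PerfectClosure K p ⊗[k] X.W) :
    X.extendInv q (coeffMap X.W (q.restrictScalars k) z) = coeffMap X.V q (X.ψ.symm z) := by
  induction z with
  | zero => simp
  | add x y hx hy => simp only [map_add, hx, hy]
  | tmul c v =>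
    have e : c ⊗ₜ[k] v = c • ((1 : PerfectClosure K p) ⊗ₜ[k] v) := by
      simp [TensorProduct.smul_tmul']
    rw [e, coeffMap_smul, map_smul, map_smul, coeffMap_smul]
    simp [extendInv]

/-- The extension of `ψ` along a homomorphism `q : K^perf → S` of `K`-algebras, as an
isomorphism. -/
def Triple.extend (q : PerfectClosure K p →ₐ[K] S) (X : Triple p k K) :
    S ⊗[K] X.V ≃ₗ[S] S ⊗[k] X.W :=
  LinearEquiv.ofLinearMap (X.extendFun q) (X.extendInv q)
    (end_ext_coeffMap X.W (q.restrictScalars k) fun z => by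
      rw [LinearMap.comp_apply, extendInv_coeffMap, extendFun_coeffMap,
        LinearEquiv.apply_symm_apply]; rfl)
    (end_ext_coeffMap X.V q fun z => by
      rw [LinearMap.comp_apply, extendFun_coeffMap, extendInv_coeffMap,
        LinearEquiv.symm_apply_apply]; rfl)

theorem Triple.extend_coeffMap (q : PerfectClosure K p →ₐ[K] S) (X : Triple p k K)
    (z : PerfectClosure K p ⊗[K] X.V) :
    X.extend q (coeffMap X.V q z) = coeffMap X.W (q.restrictScalars k) (X.ψ z) :=
  X.extendFun_coeffMap q z

theorem Triple.extend_natural (q : PerfectClosure K p →ₐ[K] S) {X Y : Triple p k K} (f : X ⟶ Y)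
    (z : S ⊗[K] X.V) : Y.extend q (f.a.baseChange S z) = f.b.baseChange S (X.extend q z) := by
  suffices h : (Y.extend q).toLinearMap ∘ₗ f.a.baseChange S =
      f.b.baseChange S ∘ₗ (X.extend q).toLinearMap from LinearMap.congr_fun h z
  refine end_ext_coeffMap X.V q fun z => ?_
  rw [LinearMap.comp_apply, LinearMap.comp_apply, LinearEquiv.coe_coe, LinearEquiv.coe_coe,
    ← coeffMap_baseChange, extend_coeffMap, extend_coeffMap, ← coeffMap_baseChange, f.comm]

theorem Triple.extend_symm_natural (q : PerfectClosure K p →ₐ[K] S) {X Y : Triple p k K}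
    (f : X ⟶ Y) (z : S ⊗[k] X.W) :
    (Y.extend q).symm (f.b.baseChange S z) = f.a.baseChange S ((X.extend q).symm z) := by
  rw [LinearEquiv.symm_apply_eq, extend_natural, LinearEquiv.apply_symm_apply]

/-- The canonical isomorphism `(S ⊗ V) ⊗_S (S ⊗ V') ≃ S ⊗ (V ⊗ V')` for two triples. -/
def tensorIsoV (S : Type u) [CommRing S] [Algebra K S] (X Y : Triple p k K) :
    (S ⊗[K] X.V) ⊗[S] (S ⊗[K] Y.V) ≃ₗ[S] S ⊗[K] (X.tensor Y).V :=
  (AlgebraTensorModule.distribBaseChange K S X.V Y.V).symm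

theorem Triple.tensor_ψ (X Y : Triple p k K) (z : PerfectClosure K p ⊗[K] X.V)
    (z' : PerfectClosure K p ⊗[K] Y.V) :
    (X.tensor Y).ψ (tensorIsoV _ X Y (z ⊗ₜ z')) = tensorIso _ X Y (X.ψ z ⊗ₜ Y.ψ z') := by
  change (AlgebraTensorModule.distribBaseChange k (PerfectClosure K p) X.W Y.W).symm
    (TensorProduct.congr X.ψ Y.ψ
      (AlgebraTensorModule.distribBaseChange K (PerfectClosure K p) X.V Y.V
        ((AlgebraTensorModule.distribBaseChange K (PerfectClosure K p) X.V Y.V).symm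
          (z ⊗ₜ z')))) = _
  rw [LinearEquiv.apply_symm_apply, TensorProduct.congr_tmul]
  rfl

theorem Triple.extend_tensor (q : PerfectClosure K p →ₐ[K] S) (X Y : Triple p k K)
    (z : S ⊗[K] X.V) (z' : S ⊗[K] Y.V) :
    (X.tensor Y).extend q (tensorIsoV S X Y (z ⊗ₜ z')) =
      tensorIso S X Y (X.extend q z ⊗ₜ Y.extend q z') := by
  have one : ∀ (V : Type u) [AddCommGroup V] [Module K V] (c : S) (v : V),
      c ⊗ₜ[K] v = c • coeffMap V q (1 ⊗ₜ v) := fun V _ _ c v => by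
    simp [TensorProduct.smul_tmul']
  induction z with
  | zero => simp
  | add x y hx hy => simp only [map_add, TensorProduct.add_tmul, hx, hy]
  | tmul c v =>
    induction z' with
    | zero => simp
    | add x y hx hy => simp only [map_add, TensorProduct.tmul_add, hx, hy]
    | tmul c' v' =>
      -- By linearity over `S` only vectors that come from `K^perf` remain, where the claim is the
      -- definition of `ψ` on a tensor product.
      have e : tensorIsoV S X Y (coeffMap X.V q (1 ⊗ₜ v) ⊗ₜ coeffMap Y.V q (1 ⊗ₜ v')) =
          coeffMap (X.tensor Y).V q (tensorIsoV _ X Y ((1 ⊗ₜ v) ⊗ₜ (1 ⊗ₜ v'))) :=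
        (coeffMap_distrib q (1 ⊗ₜ v) (1 ⊗ₜ v')).symm
      rw [one, one Y.V]
      simp only [TensorProduct.smul_tmul_smul, map_smul]
      rw [e, extend_coeffMap, extend_coeffMap, extend_coeffMap, Triple.tensor_ψ,
        coeffMap_tensorIso]

theorem Triple.extend_symm_tensor (q : PerfectClosure K p →ₐ[K] S) (X Y : Triple p k K)
    (z : S ⊗[k] X.W) (z' : S ⊗[k] Y.W) :
    ((X.tensor Y).extend q).symm (tensorIso S X Y (z ⊗ₜ z')) =
      tensorIsoV S X Y ((X.extend q).symm z ⊗ₜ (Y.extend q).symm z') := by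
  rw [LinearEquiv.symm_apply_eq, extend_tensor, LinearEquiv.apply_symm_apply,
    LinearEquiv.apply_symm_apply]

/-- On the unit triple `ψ` sends `1 ⊗ c` to `c ⊗ 1` with `c` in `K`, and a homomorphism of
`K`-algebras does not move `c`. This makes `descentAut` trivial on the unit. -/
theorem Triple.extend_unit (q q' : PerfectClosure K p →ₐ[K] S) :
    (Triple.unit p k K).extend q = (Triple.unit p k K).extend q' := by
  have key : ∀ q : PerfectClosure K p →ₐ[K] S, ∀ c : K,
      (Triple.unit p k K).extend q (1 ⊗ₜ c) = algebraMap K S c ⊗ₜ[k] (1 : k) := by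
    intro q c
    have e : (1 : S) ⊗ₜ[K] c = coeffMap K q (1 ⊗ₜ c) := by simp
    have e2 : (Triple.unit p k K).ψ (1 ⊗ₜ c) =
        algebraMap K (PerfectClosure K p) c ⊗ₜ[k] (1 : k) := by
      change (AlgebraTensorModule.rid k (PerfectClosure K p) (PerfectClosure K p)).symm
        (AlgebraTensorModule.rid K (PerfectClosure K p) (PerfectClosure K p) (1 ⊗ₜ c)) = _
      rw [AlgebraTensorModule.rid_tmul, AlgebraTensorModule.rid_symm_apply, Algebra.smul_def,
        mul_one]
    refine ((congrArg _ e).trans ((Triple.unit p k K).extend_coeffMap q (1 ⊗ₜ c))).trans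
      ((congrArg _ e2).trans ?_)
    change q.restrictScalars k (algebraMap K (PerfectClosure K p) c) ⊗ₜ[k] (1 : k) = _
    rw [AlgHom.restrictScalars_apply, AlgHom.commutes]
  refine LinearEquiv.ext fun z => ?_
  induction z with
  | zero => simp
  | add x y hx hy => simp only [map_add, hx, hy]
  | tmul s c =>
    have e : s ⊗ₜ[K] c = s • ((1 : S) ⊗ₜ[K] c) := by simp [TensorProduct.smul_tmul']
    have h : (Triple.unit p k K).extend q (1 ⊗ₜ c) = (Triple.unit p k K).extend q' (1 ⊗ₜ c) :=
      (key q c).trans (key q' c).symm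
    exact (congrArg _ e).trans (((map_smul _ s _).trans (congrArg (s • ·) h)).trans
      ((map_smul _ s _).symm.trans (congrArg _ e.symm)))

/-- The tensor automorphism over `S` that compares the extensions of `ψ` along two homomorphisms
`q, q' : K^perf → S` of `K`-algebras. -/
def descentAut (q q' : PerfectClosure K p →ₐ[K] S) : tensorAut p k K S :=
  ⟨fun X => LinearMap.GeneralLinearGroup.generalLinearEquiv S (S ⊗[k] X.W) |>.symm
      ((X.extend q').symm ≪≫ₗ X.extend q),
    { natural := fun {X Y} f z => by
        change Y.extend q ((Y.extend q').symm _) =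
          f.b.baseChange S (X.extend q ((X.extend q').symm z))
        rw [Triple.extend_symm_natural, Triple.extend_natural]
      tensor := fun X Y z z' => by
        change (X.tensor Y).extend q (((X.tensor Y).extend q').symm _) =
          tensorIso S X Y (X.extend q ((X.extend q').symm z) ⊗ₜ
            Y.extend q ((Y.extend q').symm z'))
        rw [Triple.extend_symm_tensor, Triple.extend_tensor]
      unit := fun z => by
        change (Triple.unit p k K).extend q (((Triple.unit p k K).extend q').symm z) = z
        rw [Triple.extend_unit q q', LinearEquiv.apply_symm_apply] }⟩

theorem descentAut_coeffMap (q q' : PerfectClosure K p →ₐ[K] S) (X : Triple p k K)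
    (z : PerfectClosure K p ⊗[K] X.V) :
    ((descentAut q q').1 X).val (coeffMap X.W (q'.restrictScalars k) (X.ψ z)) =
      X.extend q (coeffMap X.V q' z) := by
  change X.extend q ((X.extend q').symm _) = _
  rw [← Triple.extend_coeffMap, LinearEquiv.symm_apply_apply]

end Descent

/-- An element `x` of a `K`-algebra with `x ⊗ 1 = 1 ⊗ x` lies in `K`. -/
theorem exists_algebraMap_eq_of_tmul_one_eq {K P : Type*} [Field K] [Ring P] [Nontrivial P]
    [Algebra K P] {x : P} (h : x ⊗ₜ[K] (1 : P) = 1 ⊗ₜ x) : ∃ y, algebraMap K P y = x := by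
  -- A `K`-linear retraction `φ` of `K → P`, applied to the left factor, turns `x ⊗ 1 = 1 ⊗ x` into
  -- `φ x • 1 = x`.
  obtain ⟨φ, hφ⟩ := (Algebra.linearMap K P).exists_leftInverse_of_injective
    (LinearMap.ker_eq_bot.2 (algebraMap K P).injective)
  have h1 : φ 1 = 1 := by simpa using LinearMap.congr_fun hφ 1
  refine ⟨φ x, ?_⟩
  have := congrArg (TensorProduct.lid K P ∘ φ.rTensor P) h
  simpa [h1, Algebra.smul_def] using this

/-! ### Triples given by a basis -/

section OfBasis

variable {p : ℕ} [Fact p.Prime] {k K L : Type u} [Field k] [Field K] [Field L] [CharP K p]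
  [CharP L p] [Algebra k K] [Algebra k L]

/-- The triple `(Kⁿ, W, ψ)` in which `ψ` maps the standard basis to a given basis of
`K^perf ⊗ W`. -/
def Triple.ofBasis (W : Type u) [AddCommGroup W] [Module k W] [FiniteDimensional k W] {n : ℕ}
    (B : Module.Basis (Fin n) (PerfectClosure K p) (PerfectClosure K p ⊗[k] W)) :
    Triple p k K where
  V := Fin n → K
  W := W
  ψ := ((Pi.basisFun K (Fin n)).baseChange (PerfectClosure K p)).equiv B (Equiv.refl _)

theorem Triple.ofBasis_ψ_single (W : Type u) [AddCommGroup W] [Module k W]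
    [FiniteDimensional k W] {n : ℕ}
    (B : Module.Basis (Fin n) (PerfectClosure K p) (PerfectClosure K p ⊗[k] W)) (j : Fin n) :
    (Triple.ofBasis W B).ψ (1 ⊗ₜ (Pi.single j 1 : Fin n → K)) = B j := by
  have key : ((Pi.basisFun K (Fin n)).baseChange (PerfectClosure K p)).equiv B (Equiv.refl _)
      (1 ⊗ₜ (Pi.single j 1 : Fin n → K)) = B j := by
    have e : (1 : PerfectClosure K p) ⊗ₜ[K] (Pi.single j 1 : Fin n → K) =
        (Pi.basisFun K (Fin n)).baseChange (PerfectClosure K p) j := by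
      rw [Module.Basis.baseChange_apply, Pi.basisFun_apply]
    rw [e, Module.Basis.equiv_apply, Equiv.refl_apply]
  exact key

theorem Triple.ofBasis_ψ (W : Type u) [AddCommGroup W] [Module k W] [FiniteDimensional k W]
    {n : ℕ} (B : Module.Basis (Fin n) (PerfectClosure K p) (PerfectClosure K p ⊗[k] W))
    (v : Fin n → K) :
    (Triple.ofBasis W B).ψ (1 ⊗ₜ v) = ∑ j, PerfectClosure.of K p (v j) • B j := by
  have e : (1 : PerfectClosure K p) ⊗ₜ[K] v =
      ∑ j, PerfectClosure.of K p (v j) •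
        ((1 : PerfectClosure K p) ⊗ₜ[K] (Pi.single j 1 : Fin n → K)) := by
    conv_lhs => rw [pi_eq_sum_univ' v, TensorProduct.tmul_sum]
    refine Finset.sum_congr rfl fun j _ => ?_
    rw [TensorProduct.tmul_smul, ← algebraMap_smul (PerfectClosure K p)]
    refine congrArg₂ (· • ·) rfl (congrArg _ ?_)
    ext i
    simp [Pi.single_apply, eq_comm]
  refine (congrArg _ e).trans ((map_sum _ _ _).trans (Finset.sum_congr rfl fun j _ => ?_))
  exact (map_smul _ _ _).trans (congrArg _ (Triple.ofBasis_ψ_single W B j))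

/-- Transport of structure: a bijective `e` induces an `e`-semilinear bijection after tensoring with
`W`, so bases can be carried back. -/
theorem exists_basis_coeffMap (e : PerfectClosure K p →ₐ[k] PerfectClosure L p)
    (he : Function.Bijective e) (W : Type u) [AddCommGroup W] [Module k W] {n : ℕ}
    (B : Module.Basis (Fin n) (PerfectClosure L p) (PerfectClosure L p ⊗[k] W)) :
    ∃ B' : Module.Basis (Fin n) (PerfectClosure K p) (PerfectClosure K p ⊗[k] W),
      ∀ j, coeffMap W e (B' j) = B j := by
  let e' := AlgEquiv.ofBijective e he
  -- With scalars acting through `e`, the semilinear bijection becomes the linear equivalence `E`.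
  let _ : Module (PerfectClosure K p) (PerfectClosure L p ⊗[k] W) :=
    Module.compHom _ (e : PerfectClosure K p →+* PerfectClosure L p)
  let E₀ := LinearEquiv.rTensor W e'.toLinearEquiv
  let E : PerfectClosure K p ⊗[k] W ≃ₗ[PerfectClosure K p] PerfectClosure L p ⊗[k] W :=
    { E₀ with
      map_smul' := fun c z => coeffMap_smul W e c z }
  refine ⟨(B.mapCoeffs e'.symm.toRingEquiv fun c x => ?_).map E.symm, fun j => ?_⟩
  · change e (e'.symm c) • x = c • x
    exact congrArg (· • x) (e'.apply_symm_apply c)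
  · rw [Module.Basis.map_apply, Module.Basis.mapCoeffs_apply]
    exact E.apply_symm_apply (B j)

/-- Every triple over `L` is, up to isomorphism, the pullback of a triple over `K` if `K` and `L`
have the same perfect closure. -/
theorem exists_semiHom_surjective (f : K →ₐ[k] L) (hf : Function.Bijective (perfMap p f))
    (Y : Triple p k L) : ∃ (X : Triple p k K) (h : SemiHom f X Y), Function.Surjective h.b := by
  let b := Module.finBasis L Y.V
  -- The vectors `ψ (1 ⊗ b j)`, carried back to `K^perf ⊗ W`, span over `K` the structure sought;
  -- the fibre `W` is unchanged.
  obtain ⟨B, hB⟩ := exists_basis_coeffMap (perfMap p f) hf Y.W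
    ((b.baseChange (PerfectClosure L p)).map Y.ψ)
  refine ⟨Triple.ofBasis Y.W B,
    { a :=
      { toFun := fun v => ∑ j, f (v j) • b j
        map_add' := fun v w => by
          rw [← Finset.sum_add_distrib]
          exact Finset.sum_congr rfl fun j _ => by rw [← add_smul, ← map_add]; rfl
        map_smul' := fun c v => by
          rw [Finset.smul_sum]
          refine Finset.sum_congr rfl fun j _ => ?_
          rw [smul_smul]
          exact congrArg (· • b j) (map_mul f c (v j)) }
      b := (LinearMap.id : Y.W →ₗ[k] Y.W)
      comm := fun v => ?_ }, fun w => ⟨w, rfl⟩⟩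
  refine Eq.trans ?_ (congrArg (coeffMap Y.W (perfMap p f)) (Triple.ofBasis_ψ Y.W B v)).symm
  rw [map_sum]
  change Y.ψ (1 ⊗ₜ ∑ j, f (v j) • b j) = _
  rw [TensorProduct.tmul_sum, map_sum]
  refine Finset.sum_congr rfl fun j _ => ?_
  rw [coeffMap_smul, hB, perfMap_of, Module.Basis.map_apply, Module.Basis.baseChange_apply,
    TensorProduct.tmul_smul, ← algebraMap_smul (PerfectClosure L p), map_smul]
  rfl

end OfBasis

/-! ### Unipotent triples of rank two -/

section Shear

variable {p : ℕ} [Fact p.Prime] {k K L : Type u} [Field k] [Field K] [Field L] [CharP K p]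
  [CharP L p] [Algebra k K] [Algebra k L]

/-- The nilpotent endomorphism `(a, b) ↦ (b, 0)` of `k²`. -/
def nilp (k : Type u) [Field k] : k × k →ₗ[k] k × k := LinearMap.inl k k k ∘ₗ LinearMap.snd k k k

theorem nilp_comp_nilp (k : Type u) [Field k] : nilp k ∘ₗ nilp k = 0 := by
  ext <;> simp [nilp]

/-- The unipotent automorphism `1 + x N` of `P ⊗ k²`, where `N` is `nilp k`. -/
def shearEquiv {P : Type u} [Field P] [Algebra k P] (x : P) :
    P ⊗[k] (k × k) ≃ₗ[P] P ⊗[k] (k × k) :=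
  -- Since `N² = 0`, the inverse of `1 + x N` is `1 - x N`.
  have key : ∀ x : P, (LinearMap.id + x • (nilp k).baseChange P) ∘ₗ
      (LinearMap.id + (-x) • (nilp k).baseChange P) = LinearMap.id := fun x => by
    have h : (nilp k).baseChange P ∘ₗ (nilp k).baseChange P = 0 := by
      rw [← LinearMap.baseChange_comp, nilp_comp_nilp, LinearMap.baseChange_zero]
    simp only [LinearMap.add_comp, LinearMap.comp_add, LinearMap.id_comp, LinearMap.comp_id,
      LinearMap.smul_comp, LinearMap.comp_smul, h, smul_zero, add_zero]
    rw [add_assoc, ← add_smul, add_neg_cancel, zero_smul, add_zero]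
  LinearEquiv.ofLinearMap (LinearMap.id + x • (nilp k).baseChange P)
    (LinearMap.id + (-x) • (nilp k).baseChange P) (key x) (by simpa using key (-x))

theorem shearEquiv_tmul {P : Type u} [Field P] [Algebra k P] (x c : P) (w : k × k) :
    shearEquiv x (c ⊗ₜ[k] w) = c ⊗ₜ w + (x * c) ⊗ₜ nilp k w := by
  change c ⊗ₜ[k] w + x • (nilp k).baseChange P (c ⊗ₜ w) = _
  rw [LinearMap.baseChange_tmul, TensorProduct.smul_tmul', smul_eq_mul]

variable (k) in
/-- The triple `(K², k², 1 + x N)`, where `N` is the nilpotent matrix `nilp k`. -/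
def Triple.shear (x : PerfectClosure K p) : Triple p k K :=
  Triple.ofBasis (k × k)
    (((Module.Basis.finTwoProd k).baseChange (PerfectClosure K p)).map (shearEquiv x))

theorem Triple.shear_ψ_zero (x : PerfectClosure K p) :
    (Triple.shear k x).ψ (1 ⊗ₜ (Pi.single 0 1 : Fin 2 → K)) = 1 ⊗ₜ ((1, 0) : k × k) := by
  refine (Triple.ofBasis_ψ_single ..).trans ?_
  rw [Module.Basis.map_apply, Module.Basis.baseChange_apply, Module.Basis.finTwoProd_zero,
    shearEquiv_tmul, show nilp k (1, 0) = 0 from rfl, TensorProduct.tmul_zero, add_zero]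
  rfl

theorem Triple.shear_ψ_one (x : PerfectClosure K p) :
    (Triple.shear k x).ψ (1 ⊗ₜ (Pi.single 1 1 : Fin 2 → K)) =
      1 ⊗ₜ[k] ((0, 1) : k × k) + x ⊗ₜ ((1, 0) : k × k) := by
  refine (Triple.ofBasis_ψ_single ..).trans ?_
  rw [Module.Basis.map_apply, Module.Basis.baseChange_apply, Module.Basis.finTwoProd_one,
    shearEquiv_tmul, mul_one]
  rfl

/-- The two vectors exhibit the pullback as an extension of the unit triple by itself whose class is
the image of `x`. This is all that is needed later, so the pullback is not identified with a shear
triple over `L`. -/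
theorem exists_pullback_shear (f : K →ₐ[k] L) (x : PerfectClosure K p) :
    ∃ v₀ v₁ : ((Triple.shear k x).pullback f).V,
      ((Triple.shear k x).pullback f).ψ (1 ⊗ₜ v₀) = 1 ⊗ₜ ((1, 0) : k × k) ∧
      ((Triple.shear k x).pullback f).ψ (1 ⊗ₜ v₁) =
        1 ⊗ₜ ((0, 1) : k × k) + perfMap p f x ⊗ₜ ((1, 0) : k × k) := by
  let t := SemiHom.toPullback f (Triple.shear k x)
  refine ⟨t.a (Pi.single 0 1 : Fin 2 → K), t.a (Pi.single 1 1 : Fin 2 → K), ?_, ?_⟩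
  · refine (t.comm _).trans ((congrArg _ (Triple.shear_ψ_zero x)).trans ?_)
    change perfMap p f 1 ⊗ₜ ((1, 0) : k × k) = _
    rw [map_one]
  · refine (t.comm _).trans ((congrArg _ (Triple.shear_ψ_one x)).trans ((map_add _ _ _).trans ?_))
    exact congrArg (fun c => (c ⊗ₜ[k] (0, 1) + perfMap p f x ⊗ₜ[k] (1, 0) :
      PerfectClosure L p ⊗[k] (k × k))) (map_one (perfMap p f))

end Shear

/-! ### Fixed vectors and descent from `K^perf ⊗ K^perf` to `K` -/

section Invariants

variable {p : ℕ} [Fact p.Prime] {k K : Type u} [Field k] [Field K] [CharP K p] [Algebra k K]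

/-- A vector of `W` that comes from `V` is fixed by all tensor automorphisms. -/
theorem IsTensorAut.fixed {R : Type u} [CommRing R] [Algebra k R]
    {g : ∀ X : Triple p k K, (Module.End R (R ⊗[k] X.W))ˣ} (hg : IsTensorAut p k K R g)
    (X : Triple p k K) (v : X.V) (w : X.W) (h : X.ψ (1 ⊗ₜ v) = 1 ⊗ₜ w) :
    (g X).val (1 ⊗ₜ w) = 1 ⊗ₜ w := by
  -- The pair `(v, w)` is a morphism from the unit triple, on which tensor automorphisms act
  -- trivially; naturality then gives the claim.
  let m : Triple.unit p k K ⟶ X :=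
    { a := (LinearMap.toSpanSingleton K X.V v : K →ₗ[K] X.V)
      b := (LinearMap.toSpanSingleton k X.W w : k →ₗ[k] X.W)
      comm := by
        have key : ∀ z : PerfectClosure K p ⊗[K] K,
            X.ψ ((LinearMap.toSpanSingleton K X.V v).baseChange (PerfectClosure K p) z) =
            (LinearMap.toSpanSingleton k X.W w).baseChange (PerfectClosure K p)
              ((AlgebraTensorModule.rid k (PerfectClosure K p) (PerfectClosure K p)).symm
              (AlgebraTensorModule.rid K (PerfectClosure K p) (PerfectClosure K p) z)) := by
          intro z
          induction z with
          | zero => simp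
          | add x y hx hy => simp only [map_add, hx, hy]
          | tmul c a =>
            have e : c ⊗ₜ[K] (a • v) = (a • c) • ((1 : PerfectClosure K p) ⊗ₜ[K] v) := by
              rw [TensorProduct.smul_tmul', smul_eq_mul, mul_one, TensorProduct.smul_tmul]
            rw [LinearMap.baseChange_tmul, LinearMap.toSpanSingleton_apply, e, map_smul, h]
            simp [TensorProduct.smul_tmul']
        exact key }
  have e : m.b.baseChange R (1 ⊗ₜ (1 : k)) = 1 ⊗ₜ w := by
    refine (LinearMap.baseChange_tmul ..).trans ?_
    exact congrArg _ (one_smul k w)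
  have := hg.natural m (1 ⊗ₜ (1 : k))
  rw [hg.unit] at this
  rwa [e] at this

/-- In an extension of the line spanned by `w₀` with class `t`, the vector `w₁` is fixed by the
canonical tensor automorphism over `K^perf ⊗ K^perf` only if `t` lies in `K`. -/
theorem exists_of_descentAut_fixed (X : Triple p k K) (v₀ v₁ : X.V) (w₀ w₁ : X.W)
    (t : PerfectClosure K p) (h₀ : X.ψ (1 ⊗ₜ v₀) = 1 ⊗ₜ w₀)
    (h₁ : X.ψ (1 ⊗ₜ v₁) = 1 ⊗ₜ w₁ + t ⊗ₜ w₀) (φ : X.W →ₗ[k] k) (hφ : φ w₀ = 1)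
    (h : ((descentAut (k := k) (p := p)
      (Algebra.TensorProduct.includeLeft (R := K) (S := K) (A := PerfectClosure K p)
        (B := PerfectClosure K p)) Algebra.TensorProduct.includeRight).1 X).val (1 ⊗ₜ w₁) =
          1 ⊗ₜ w₁) :
    ∃ y : K, PerfectClosure.of K p y = t := by
  let P := PerfectClosure K p
  let q : P →ₐ[K] P ⊗[K] P := Algebra.TensorProduct.includeLeft
  let q' : P →ₐ[K] P ⊗[K] P := Algebra.TensorProduct.includeRight
  -- The preimage of `w₁` under `ψ` has the coefficient `t`, which `q` and `q'` map to different
  -- elements in general.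
  have hz : X.ψ (1 ⊗ₜ v₁ - t ⊗ₜ v₀) = 1 ⊗ₜ w₁ := by
    have e : t ⊗ₜ[K] v₀ = t • ((1 : P) ⊗ₜ[K] v₀) := by simp [P, TensorProduct.smul_tmul']
    rw [map_sub, h₁, e, map_smul, h₀, TensorProduct.smul_tmul', smul_eq_mul, mul_one,
      add_sub_cancel_right]
  have hc : ∀ (q : P →ₐ[K] P ⊗[K] P) (w : X.W),
      coeffMap X.W (q.restrictScalars k) (1 ⊗ₜ w) = 1 ⊗ₜ w := fun q w => by simp
  have hv : ∀ (q : P →ₐ[K] P ⊗[K] P) (c : P) (v : X.V),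
      coeffMap X.V q (c ⊗ₜ v) = q c ⊗ₜ v := fun q c v => by simp
  -- Pulling `w₁` back along `q'` gives `v₁ - q' t • v₀`; pushing this forward along `q` gives `w₁ +
  -- (q t - q' t) • w₀`.
  have main := descentAut_coeffMap (k := k) q q' X (1 ⊗ₜ v₁ - t ⊗ₜ v₀)
  rw [hz, hc] at main
  have e : q' t ⊗ₜ[K] v₀ = q' t • coeffMap X.V q (1 ⊗ₜ v₀) := by
    rw [hv, map_one, TensorProduct.smul_tmul', smul_eq_mul, mul_one]
  have e1 : coeffMap X.V q' (1 ⊗ₜ v₁) = coeffMap X.V q (1 ⊗ₜ v₁) := by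
    rw [hv, hv, map_one, map_one]
  rw [map_sub, hv q' t, e, e1, map_sub, map_smul, Triple.extend_coeffMap, Triple.extend_coeffMap,
    h₀, h₁, map_add, hc, hc] at main
  have h2 := h.symm.trans main
  have e2 : coeffMap X.W (q.restrictScalars k) (t ⊗ₜ w₀) = q t ⊗ₜ w₀ := by simp
  rw [e2, add_sub_assoc, left_eq_add, sub_eq_zero, TensorProduct.smul_tmul', smul_eq_mul,
    mul_one] at h2
  -- The functional `φ` extracts the coefficient of `w₀`, leaving `t ⊗ 1 = 1 ⊗ t`.
  have h3 := congrArg (fun z => AlgebraTensorModule.rid k (P ⊗[K] P) (P ⊗[K] P)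
    (φ.baseChange (P ⊗[K] P) z)) h2
  simp only [LinearMap.baseChange_tmul, hφ, AlgebraTensorModule.rid_tmul, one_smul] at h3
  exact exists_algebraMap_eq_of_tmul_one_eq h3

end Invariants

/-! ### Closed immersions of affine group schemes -/

namespace AffineGroupScheme

variable {k : Type u} [Field k] {G H : AffineGroupScheme k} (φ : G ⟶ H)

theorem onPoints_map {R S : CommAlgCat.{u} k} (f : R ⟶ S) (g : G.points R) :
    onPoints φ S ((G.obj.map f).hom g) = (H.obj.map f).hom (onPoints φ R g) :=
  congrArg (fun h => h.hom g) (φ.hom.naturality f)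

/-- Yoneda: on points, `φ` is precomposition with its comorphism, because every point is the image
of the universal one. -/
theorem onPoints_homEquiv {A B : CommAlgCat.{u} k} (a : G.CoordinateRing A)
    (b : H.CoordinateRing B) {R : CommAlgCat.{u} k} (f : A ⟶ R) :
    onPoints φ R (a.homEquiv f) = b.homEquiv (comorphism φ a b ≫ f) := by
  rw [b.homEquiv_comp, comorphism, Equiv.apply_symm_apply, a.homEquiv_eq f]
  exact onPoints_map φ f _

variable {φ}

/-- Coordinate rings are unique up to isomorphism, and a change of them composes the comorphism with
isomorphisms on both sides. One choice therefore suffices. -/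
theorem isClosedImmersion_of_surjective {A B : CommAlgCat.{u} k} (a : G.CoordinateRing A)
    (b : H.CoordinateRing B) (h : Function.Surjective (comorphism φ a b).hom) :
    IsClosedImmersion φ := by
  intro A' B' a' b'
  have hsurj : ∀ {C D : CommAlgCat.{u} k} (i : C ≅ D), Function.Surjective i.hom.hom :=
    fun i x => ⟨i.inv.hom x, congrArg (fun t => t.hom x) i.inv_hom_id⟩
  have hi : a.homEquiv (a.uniqueUpToIso a').hom = a'.homEquiv (𝟙 A') :=
    a.homEquiv.apply_symm_apply _
  have hj : b'.homEquiv (b'.uniqueUpToIso b).hom = b.homEquiv (𝟙 B) :=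
    b'.homEquiv.apply_symm_apply _
  have e : comorphism φ a' b' =
      (b'.uniqueUpToIso b).hom ≫ comorphism φ a b ≫ (a.uniqueUpToIso a').hom := by
    refine b'.homEquiv.injective ?_
    rw [b'.homEquiv_comp, hj, ← b.homEquiv_eq, ← onPoints_homEquiv, hi, onPoints_homEquiv φ a' b',
      Category.comp_id]
  rw [e]
  exact (hsurj _).comp (h.comp (hsurj _))

/-- Two homomorphisms out of `A` that agree after composition with a surjection onto `A` are equal.
-/
theorem IsClosedImmersion.onPoints_injective (h : IsClosedImmersion φ) (R : CommAlgCat.{u} k) :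
    Function.Injective (onPoints φ R) := by
  obtain ⟨A, ⟨a⟩⟩ := G.property
  obtain ⟨B, ⟨b⟩⟩ := H.property
  intro x y hxy
  obtain ⟨f, rfl⟩ := a.homEquiv.surjective x
  obtain ⟨g, rfl⟩ := a.homEquiv.surjective y
  rw [onPoints_homEquiv φ a b, onPoints_homEquiv φ a b] at hxy
  have e := b.homEquiv.injective hxy
  refine congrArg _ (CommAlgCat.hom_ext (AlgHom.ext fun x => ?_))
  obtain ⟨z, rfl⟩ := h A B a b x
  exact congrArg (fun t => t.hom z) e

theorem IsClosedImmersion.hom_ext (h : IsClosedImmersion φ) {F : AffineGroupScheme k}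
    {α β : F ⟶ G} (e : α ≫ φ = β ≫ φ) : α = β :=
  ObjectProperty.hom_ext _ (NatTrans.ext (funext fun R => GrpCat.hom_ext (MonoidHom.ext fun g =>
    h.onPoints_injective R (congrArg (fun t => onPoints t R g) e))))

/-- The image of a closed immersion, as a closed subgroup scheme. -/
def IsClosedImmersion.range (h : IsClosedImmersion φ) : H.ClosedSubgroup where
  carrier R := (onPoints φ R).range
  map_mem f g := by
    rintro ⟨x, rfl⟩
    exact ⟨(G.obj.map f).hom x, onPoints_map φ f x⟩
  closed B b := by
    obtain ⟨A, ⟨a⟩⟩ := G.property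
    let c := (comorphism φ a b).hom
    have hc : Function.Surjective c := h A B a b
    -- A point `f : B → R` comes from `G` exactly when it factors through the quotient `A` of `B`,
    -- that is, when it kills the kernel of the comorphism.
    refine ⟨RingHom.ker c, fun R f => ⟨?_, fun hf => ?_⟩⟩
    · rintro ⟨x, hx⟩ z hz
      obtain ⟨g, rfl⟩ := a.homEquiv.surjective x
      rw [onPoints_homEquiv φ a b] at hx
      rw [← b.homEquiv.injective hx]
      exact (congrArg g.hom (RingHom.mem_ker.1 hz)).trans (map_zero g.hom)
    · let g : A →ₐ[k] R :=
        (Ideal.Quotient.liftₐ (RingHom.ker c) f.hom hf).comp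
          (Ideal.quotientKerAlgEquivOfSurjective hc).symm.toAlgHom
      have hg : ∀ z, g (c z) = f.hom z := fun z => by
        have : (Ideal.quotientKerAlgEquivOfSurjective hc).symm (c z) =
            Ideal.Quotient.mk (RingHom.ker c) z := by
          rw [AlgEquiv.symm_apply_eq]; rfl
        exact congrArg (Ideal.Quotient.liftₐ (RingHom.ker c) f.hom hf) this
      refine ⟨a.homEquiv (CommAlgCat.ofHom g), ?_⟩
      rw [onPoints_homEquiv φ a b]
      exact congrArg _ (CommAlgCat.hom_ext (AlgHom.ext hg))

end AffineGroupScheme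

/-! ### Purely inseparable extensions -/

section Perf

variable {p : ℕ} [Fact p.Prime] {k K : Type u} [Field k] [Field K] [CharP K p] [Algebra k K]

/-- Some `p ^ n`-th power of an element of `L^perf` comes from `K`. The `p ^ n`-th root of that
element in `K^perf` maps to the given one, since Frobenius is injective on `L^perf`. -/
theorem perfMap_bijective (L : PI k K) :
    Function.Bijective (perfMap p (IsScalarTower.toAlgHom k K L)) := by
  refine ⟨(perfMap p (IsScalarTower.toAlgHom k K L)).toRingHom.injective, fun y => ?_⟩
  have : IsPRadical ((PerfectClosure.of L p).comp (algebraMap K L)) p :=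
    IsPRadical.trans (algebraMap K L) (PerfectClosure.of L p) p
  obtain ⟨n, c, hc⟩ := IsPRadical.pow_mem ((PerfectClosure.of L p).comp (algebraMap K L)) p y
  obtain ⟨z, hz⟩ := (bijective_iterateFrobenius (PerfectClosure K p) p n).2
    (PerfectClosure.of K p c)
  refine ⟨z, (bijective_iterateFrobenius (PerfectClosure L p) p n).1 ?_⟩
  rw [iterateFrobenius_def] at hz
  rw [iterateFrobenius_def, iterateFrobenius_def, ← map_pow, hz, perfMap_of, ← hc]
  rfl

/-- A homomorphism between two purely inseparable extensions of `K` exists if every element of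
the first one lies in the second one, as subfields of the perfect closure of `K`. -/
theorem exists_hom_of_perfMap (L M : PI k K)
    (h : ∀ (t : PerfectClosure K p) (x : L),
      perfMap p (IsScalarTower.toAlgHom k K L) t = PerfectClosure.of L p x →
        ∃ y : M, PerfectClosure.of M p y = perfMap p (IsScalarTower.toAlgHom k K M) t) :
    Nonempty (L ⟶ M) := by
  let e := AlgEquiv.ofBijective _ (perfMap_bijective (p := p) L)
  have he : ∀ c : K, e.symm (PerfectClosure.of L p (algebraMap K L c)) =
      PerfectClosure.of K p c := fun c => by
    rw [AlgEquiv.symm_apply_eq]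
    exact (perfMap_of p (IsScalarTower.toAlgHom k K L) c).symm
  -- `L` is embedded in `M^perf` through the common perfect closure `K^perf`; the hypothesis says
  -- that its image lies in that of `M`.
  let θ : L →ₐ[K] PerfectClosure M p :=
    { ((perfMap p (IsScalarTower.toAlgHom k K M)).toRingHom.comp
        (e.symm.toAlgHom.toRingHom.comp (PerfectClosure.of L p))) with
      commutes' := fun c => by
        change perfMap p (IsScalarTower.toAlgHom k K M) (e.symm _) = _
        rw [he, perfMap_of]
        rfl }
  let σ : M →ₐ[K] PerfectClosure M p := IsScalarTower.toAlgHom K M (PerfectClosure M p)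
  have hθ : ∀ x, θ x ∈ σ.range := fun x => by
    obtain ⟨y, hy⟩ := h (e.symm (PerfectClosure.of L p x)) x (e.apply_symm_apply _)
    exact ⟨y, hy⟩
  exact ⟨(AlgEquiv.ofInjectiveField σ).symm.toAlgHom.comp (θ.codRestrict σ.range hθ)⟩

end Perf

/-! ### Closed immersions, inclusions of subgroups and fullness -/

section Main

variable {p : ℕ} [Fact p.Prime] {k K L : Type u} [Field k] [Field K] [Field L] [CharP K p]
  [CharP L p] [Algebra k K] [Algebra k L]

theorem signed_map {R S : Type u} [CommRing R] [Algebra k R] [CommRing S] [Algebra k S]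
    (f : R →ₐ[k] S) (g : tensorAut p k K R) (s : Bool) :
    signed (tensorAutMap p k K f g) s = tensorAutMap p k K f (signed g s) := by
  cases s
  · exact (map_inv _ _).symm
  · rfl

theorem signed_res (f : K →ₐ[k] L) {R : Type u} [CommRing R] [Algebra k R]
    (g : tensorAut p k L R) (s : Bool) : signed (res p f R g) s = res p f R (signed g s) := by
  cases s
  · exact (map_inv _ _).symm
  · rfl

/-- The homomorphism of coordinate rings attached to an extension with the same perfect closure
is surjective. -/
theorem evalAt_res_univAut_surjective (f : K →ₐ[k] L) (hf : Function.Bijective (perfMap p f)) :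
    Function.Surjective
      (evalAt (CommAlgCat.of k (CoordRing p k L)) (res p f _ (univAut p k L))) := by
  let φ : CoordRing p k K →ₐ[k] CoordRing p k L :=
    evalAt (CommAlgCat.of k (CoordRing p k L)) (res p f _ (univAut p k L))
  have hφ : tensorAutMap p k K φ (univAut p k K) = res p f _ (univAut p k L) :=
    map_evalAt (CommAlgCat.of k (CoordRing p k L)) _
  -- The coordinate ring is generated by the matrix coefficients of the universal automorphism and
  -- of its inverse.
  suffices hX : ∀ x, Ideal.Quotient.mkₐ k (coordIdeal p k L) (MvPolynomial.X x) ∈ φ.range by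
    have : (Ideal.Quotient.mkₐ k (coordIdeal p k L)).range ≤ φ.range := by
      rw [← Algebra.map_top, ← MvPolynomial.adjoin_range_X, AlgHom.map_adjoin]
      refine Algebra.adjoin_le ?_
      rintro _ ⟨_, ⟨x, rfl⟩, rfl⟩
      exact hX x
    intro y
    obtain ⟨z, rfl⟩ := Ideal.Quotient.mk_surjective y
    exact this ⟨z, rfl⟩
  rintro ⟨c, s, i, j⟩
  -- As `rep c` comes from a triple `X` over `K`, naturality along `h` computes the universal
  -- automorphism on `rep c` from its restriction to `X`.
  obtain ⟨X, h, hb⟩ := exists_semiHom_surjective f hf (rep (k := k) c)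
  obtain ⟨w, hw⟩ := hb (repBasis c j)
  have nat := resFamily_natural (signed (univAut p k L) s).2 h (1 ⊗ₜ w)
  rw [LinearMap.baseChange_tmul, hw, univAut_signed, univEnd_basis] at nat
  -- By the choice of `φ`, that restriction is the image under `φ` of the universal automorphism
  -- over `K`, so its coefficients lie in the range of `φ`.
  have e1 : resFamily f (signed (univAut p k L) s).1 X =
      (tensorAutMap p k K φ (signed (univAut p k K) s)).1 X := by
    rw [← signed_map, hφ, signed_res]
    rfl
  have e2 : (1 : CoordRing p k L) ⊗ₜ[k] w = coeffMap X.W φ (1 ⊗ₜ w) := by simp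
  have e3 := coeffMap_units φ X.W ((signed (univAut p k K) s).1 X) (1 ⊗ₜ w)
  rw [e1, e2] at nat
  have e4 := nat.trans ((congrArg (h.b.baseChange (CoordRing p k L)) e3).trans
    (coeffMap_baseChange φ h.b _).symm)
  have e5 := congrArg (fun y => ((repBasis c).baseChange (CoordRing p k L)).repr y i) e4
  refine ⟨_, ((repr_coeffMap (repBasis c) φ _ i).symm.trans e5.symm).trans ?_⟩
  rw [map_sum, Finset.sum_apply']
  simp [Module.Basis.baseChange_repr_tmul, Finsupp.single_apply]

theorem PI.isClosedImmersion_toBase (L : PI k K) :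
    AffineGroupScheme.IsClosedImmersion (L.toBase p) := by
  refine AffineGroupScheme.isClosedImmersion_of_surjective (autRepresentable p k L)
    (autRepresentable p k K) ?_
  -- The universal point is `univAut`, so the comorphism is evaluation at its restriction to `K`.
  have e : (autRepresentable p k L).homEquiv (𝟙 (CommAlgCat.of k (CoordRing p k L))) =
      univAut p k L :=
    congrArg (fun t => t.hom (univAut p k L))
      ((autFunctor p k L).map_id (CommAlgCat.of k (CoordRing p k L)))
  have e' : AffineGroupScheme.comorphism (L.toBase p) (autRepresentable p k L)
      (autRepresentable p k K) = CommAlgCat.ofHom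
        (evalAt (CommAlgCat.of k (CoordRing p k L))
          (res p (IsScalarTower.toAlgHom k K L) _ (univAut p k L))) :=
    congrArg (fun t => CommAlgCat.ofHom (evalAt (CommAlgCat.of k (CoordRing p k L))
      (res p (IsScalarTower.toAlgHom k K L) _ t))) e
  rw [e']
  exact evalAt_res_univAut_surjective _ (perfMap_bijective L)

/-- A single point of `π(L/k)`, the descent datum over `P ⊗_L P`, detects membership in `L`. It is
tested on the shear triples of those `t` whose image lies in `M`. -/
theorem PI.exists_hom_of_range_le (L M : PI k K)
    (h : ∀ R : CommAlgCat.{u} k, (AffineGroupScheme.onPoints (L.toBase p) R).range ≤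
      (AffineGroupScheme.onPoints (M.toBase p) R).range) : Nonempty (M ⟶ L) := by
  refine exists_hom_of_perfMap (p := p) M L fun t x hx => ?_
  let P := PerfectClosure L p
  let g : tensorAut p k L (P ⊗[L] P) :=
    descentAut Algebra.TensorProduct.includeLeft Algebra.TensorProduct.includeRight
  obtain ⟨g', hg'⟩ := h (CommAlgCat.of k (P ⊗[L] P)) ⟨g, rfl⟩
  -- The points `g` and `g'` have the same image in `π(K/k)`, and pullback does not change the fibre
  -- `k × k`, so both act on it in the same way.
  have hg : (g'.1 ((Triple.shear k t).pullback (IsScalarTower.toAlgHom k K M))).val =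
      (g.1 ((Triple.shear k t).pullback (IsScalarTower.toAlgHom k K L))).val :=
    congrArg (fun s : tensorAut p k K (P ⊗[L] P) => (s.1 (Triple.shear k t)).val) hg'
  obtain ⟨v₀, v₁, h₀, h₁⟩ := exists_pullback_shear (IsScalarTower.toAlgHom k K L) t
  obtain ⟨u₀, u₁, h₀', h₁'⟩ := exists_pullback_shear (IsScalarTower.toAlgHom k K M) t
  refine exists_of_descentAut_fixed _ v₀ v₁ ((1, 0) : k × k) ((0, 1) : k × k) _ h₀ h₁
    (LinearMap.fst k k k) rfl ?_
  -- Since `t` becomes `x` in `M`, the combination `u₁ - x • u₀` is defined over `M` and cancels the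
  -- off-diagonal entry.
  have hfix := IsTensorAut.fixed g'.2 _ (u₁ - x • u₀) ((0, 1) : k × k) (by
    rw [TensorProduct.tmul_sub, map_sub, TensorProduct.tmul_smul,
      ← algebraMap_smul (PerfectClosure M p) x, map_smul, h₀', h₁', hx]
    have key : ∀ c : PerfectClosure M p, (1 ⊗ₜ[k] (0, 1) + c ⊗ₜ[k] (1, 0) - c • 1 ⊗ₜ[k] (1, 0) :
        PerfectClosure M p ⊗[k] (k × k)) = 1 ⊗ₜ[k] (0, 1) := fun c => by
      rw [TensorProduct.smul_tmul', smul_eq_mul, mul_one, add_sub_cancel_right]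
    exact key _)
  exact (LinearMap.congr_fun hg.symm _).trans hfix

theorem PI.range_le_of_hom {L M : PI k K} (f : M ⟶ L) (R : CommAlgCat.{u} k) :
    (AffineGroupScheme.onPoints (L.toBase p) R).range ≤
      (AffineGroupScheme.onPoints (M.toBase p) R).range := by
  rintro _ ⟨x, rfl⟩
  rw [← PI.map_toBase p f]
  exact ⟨AffineGroupScheme.onPoints (piLMap p (PI.homBase f)) R x, rfl⟩

theorem PI.range_le_iff (L M : PI k K) :
    (PI.isClosedImmersion_toBase (p := p) L).range ≤
      (PI.isClosedImmersion_toBase (p := p) M).range ↔ Nonempty (M ⟶ L) :=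
  ⟨PI.exists_hom_of_range_le L M, fun ⟨f⟩ => PI.range_le_of_hom f⟩

variable (p k K) in
/-- The closed subgroup scheme attached to an isomorphism class of purely inseparable
extensions. -/
def subgroupEmbedding : (ThinSkeleton (PI k K))ᵒᵈ ↪o (piL p k K).ClosedSubgroup :=
  OrderEmbedding.ofMapLEIff
    (fun x => @Quotient.lift _ _ (isIsomorphicSetoid (PI k K))
      (fun L : PI k K => (PI.isClosedImmersion_toBase (p := p) L).range)
      -- Isomorphic extensions give subgroups contained in each other, hence equal ones.
      (fun _ _ h => h.elim fun i => le_antisymm ((PI.range_le_iff _ _).2 ⟨i.inv⟩)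
        ((PI.range_le_iff _ _).2 ⟨i.hom⟩)) (OrderDual.ofDual x))
    (fun x y => by
      obtain ⟨L⟩ := x
      obtain ⟨M⟩ := y
      -- The order on `ThinSkeleton` is existence of a morphism; in the dual, `L ≤ M` means that
      -- there is a morphism from `M` to `L`.
      exact PI.range_le_iff L M)

instance piFunctor_full : (piFunctor k K p).Full where
  map_surjective {L M} φ := by
    have hφ : φ.left ≫ M.unop.toBase p = L.unop.toBase p := Over.w φ
    -- A factorization of `π(L/k) → π(K/k)` through `π(M/k)` gives the inclusion of images. The map
    -- induced by `f` is another such factorization, so it equals `φ`.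
    obtain ⟨f⟩ := PI.exists_hom_of_range_le (p := p) L.unop M.unop fun R => by
      rintro _ ⟨x, rfl⟩
      rw [← hφ]
      exact ⟨AffineGroupScheme.onPoints φ.left R x, rfl⟩
    refine ⟨f.op, Over.OverMorphism.ext ?_⟩
    exact (PI.isClosedImmersion_toBase (p := p) M.unop).hom_ext
      ((PI.map_toBase p f).trans hφ.symm)

end Main

end LocalNori

end

theorem theoremI (p : ℕ) [Fact p.Prime] (k K : Type u) [Field k] [PerfectField k] [CharP k p]
    [Field K] [CharP K p] [Algebra k K] :
    (LocalNori.piFunctor k K p).Full ∧ (LocalNori.piFunctor k K p).Faithful ∧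
    (∀ L : LocalNori.PI k K, LocalNori.AffineGroupScheme.IsClosedImmersion (L.toBase p)) ∧
    ∃ e : (ThinSkeleton (LocalNori.PI k K))ᵒᵈ ↪o (LocalNori.piL p k K).ClosedSubgroup,
      ∀ (L : LocalNori.PI k K) (R : CommAlgCat.{u} k),
        (e (OrderDual.toDual (ThinSkeleton.mk L))).carrier R =
          (LocalNori.AffineGroupScheme.onPoints (L.toBase p) R).range :=
  -- Faithfulness is automatic: there is at most one morphism between two purely inseparable
  -- extensions.
  ⟨LocalNori.piFunctor_full, ⟨fun _ => Subsingleton.elim _ _⟩,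
    LocalNori.PI.isClosedImmersion_toBase, LocalNori.subgroupEmbedding p k K, fun _ _ => rfl⟩
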